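/- **Timed words.** Let $\Sigma$ be a finite alphabet. A timed word is a finite sequence $(\sigma_1,t_1)\cdots(\sigma_r,t_r)\in(\Sigma\times\mathbb R_{\ge 0})^*$ with $0\le t_1\le\dots\le t_r$; its last timestamp is $t_r$, and $0$ if the word is empty. For a set $L$ of timed words and a timed word $w$, let $w^{-1}L$ be the set of timed words $v$ such that $wv$ is a timed word and $wv\in L$. A timed automorphism is a monotonic bijection $\pi:\mathbb R\to\mathbb R$ with $\pi(a+1)=\pi(a)+1$ for all $a$; it acts on words by acting on the timestamps. For $S\subseteq\mathbb R_{\ge0}$, $L$ is $S$-invariant if, for every timed automorphism $\pi$ with $\pi(s)=s$ for all $s\in S$ and every timed word $v$ such that $\pi(v)$ is a timed word, $v\in L\iff\pi(v)\in L$. **Automata.** Clock constraints are Boolean combinations of $x-y\sim z$ and $x\sim z$ with $x,y$ clocks, $z\in\mathbb Z$ and $\sim\,\in\{=,<,\le,>,\ge\}$; a clock valuation assigns a nonnegative real to each clock. A $k,m$-region is a minimal nonempty set of valuations of $k$ clocks among those definable by a constraint whose constants have absolute value at most $m$; let $\mathrm{reg}(k,m)$ be the (finite) number of $k,m$-regions.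 A timed automaton (NTA) has finite sets of clocks, of locations (some initial, some final) and of rules $(p,\sigma,\varphi,Y,q)$, with $p,q$ locations, $\sigma\in\Sigma$, $\varphi$ a clock constraint, $Y$ a set of clocks. A run over $(\sigma_1,t_1)\cdots(\sigma_r,t_r)$ starts in an initial location at time $0$ with all clocks last reset at time $0$; on reading $(\sigma_i,t_i)$ it may use a rule $(p,\sigma_i,\varphi,Y,q)$ leaving its current location $p$ if $\varphi$ holds when each clock has as value $t_i$ minus the time of its last reset; it then moves to $q$ and resets the clocks in $Y$ at time $t_i$. The language $L(A)$ is the set of timed words with a run that ends in a final location. The automaton is deterministic (a DTA) if it has exactly one initial location and any two rules with the same source location, the same letter and jointly satisfiable constraints have the same reset set and the same target location. It is always resetting if $Y\neq\emptyset$ in every rule. A $k$-DTA is a DTA with $k$ clocks, and a $\mathrm{DTA}_{k,m}$ is a $k$-DTA all of whose constants have absolute value at most $m$. **Lemma.** Let $A$ be an NTA with one clock, with $n$ locations, and with all constants of absolute value at most $m$, where $m\ge 0$, and let $k\ge1$. The following are equivalent: 1. $L(A)=L(B)$ for some always resetting $k$-DTA $B$; 2. for every timed word $w$ there is a set $S\subseteq\mathbb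 R_{\ge0}$ of size at most $k$ which contains the last timestamp of $w$ and such that $w^{-1}L(A)$ is $S$-invariant; 3. $L(A)=L(B)$ for some always resetting $\mathrm{DTA}_{k,m}$ $B$ with at most $f(k,m,n)$ locations, where $f(k,m,n)=\mathrm{reg}(k,m)\cdot2^{n(2km+1)}$ if $m\ge1$, and $f(k,0,n)=\mathrm{reg}(k,0)\cdot2^{2n}$. -/

import Mathlib

namespace Timed

/-! Timed words and languages -/

/-- A timed word: a finite sequence of letters with nonnegative, weakly increasing timestamps. -/
def IsTimedWord {Alph : Type*} (w : List (Alph × ℝ)) : Prop :=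
  (∀ a ∈ w, 0 ≤ a.2) ∧ w.Pairwise (fun a b => a.2 ≤ b.2)

/-- The last timestamp of a word; for the empty word it is `0`, the time at which runs start. -/
def lastTime {Alph : Type*} (w : List (Alph × ℝ)) : ℝ :=
  (w.map Prod.snd).getLastD 0

/-- The left quotient `w⁻¹ L`. The concatenation of `w` and `v` is defined only when it is
monotonic. -/
def leftQuotient {Alph : Type*} (w : List (Alph × ℝ)) (L : Set (List (Alph × ℝ))) :
    Set (List (Alph × ℝ)) :=
  {v | IsTimedWord v ∧ IsTimedWord (w ++ v) ∧ w ++ v ∈ L}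

/-! Timed automorphisms and invariance -/

/-- Timed automorphisms: monotonic bijections of the reals that commute with `+1`. -/
def IsTimedAutomorphism (π : ℝ ≃o ℝ) : Prop :=
  ∀ a : ℝ, π (a + 1) = π a + 1

/-- Pointwise action of a map of the reals on the timestamps of a word. -/
def mapWord {Alph : Type*} (π : ℝ → ℝ) (w : List (Alph × ℝ)) : List (Alph × ℝ) :=
  w.map (fun a => (a.1, π a.2))

/-- `S`-invariance of a timed language: membership is preserved, in both directions, by every timed
automorphism that fixes `S` pointwise, wherever its value is again a timed word (that is, wherever
it does not make a timestamp negative). -/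
def IsInvariantUnder {Alph : Type*} (S : Set ℝ) (L : Set (List (Alph × ℝ))) : Prop :=
  ∀ π : ℝ ≃o ℝ, IsTimedAutomorphism π → (∀ s ∈ S, π s = s) →
    ∀ w : List (Alph × ℝ), IsTimedWord w → IsTimedWord (mapWord π w) →
      (w ∈ L ↔ mapWord π w ∈ L)

/-! Clock constraints and regions -/

/-- The comparison operators `=, <, ≤, >, ≥`. -/
inductive Cmp
  | eq | lt | le | gt | ge

instance : Finite Cmp :=
  Finite.of_surjective
    (fun i : Fin 5 => match i with
      | 0 => Cmp.eq | 1 => Cmp.lt | 2 => Cmp.le | 3 => Cmp.gt | 4 => Cmp.ge)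
    (fun c => by cases c; exacts [⟨0, rfl⟩, ⟨1, rfl⟩, ⟨2, rfl⟩, ⟨3, rfl⟩, ⟨4, rfl⟩])

def Cmp.holds : Cmp → ℝ → ℝ → Prop
  | .eq, a, b => a = b
  | .lt, a, b => a < b
  | .le, a, b => a ≤ b
  | .gt, a, b => a > b
  | .ge, a, b => a ≥ b

/-- Clock constraints over the clocks `X`. -/
inductive Constraint (X : Type*)
  | tt : Constraint X
  | ff : Constraint X
  | diff (x y : X) (c : Cmp) (z : ℤ) : Constraint X
  | clock (x : X) (c : Cmp) (z : ℤ) : Constraint X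
  | not (φ : Constraint X) : Constraint X
  | and (φ ψ : Constraint X) : Constraint X
  | or (φ ψ : Constraint X) : Constraint X

namespace Constraint

variable {X : Type*}

/-- The valuation `v` satisfies the constraint. -/
def Sat (v : X → ℝ) : Constraint X → Prop
  | tt => True
  | ff => False
  | diff x y c z => c.holds (v x - v y) z
  | clock x c z => c.holds (v x) z
  | not φ => ¬ φ.Sat v
  | and φ ψ => φ.Sat v ∧ ψ.Sat v
  | or φ ψ => φ.Sat v ∨ ψ.Sat v

/-- All constants of the constraint have absolute value at most `m`. -/
def ConstBoundedBy (m : ℕ) : Constraint X → Prop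
  | tt => True
  | ff => True
  | diff _ _ _ z => |z| ≤ (m : ℤ)
  | clock _ _ z => |z| ≤ (m : ℤ)
  | not φ => φ.ConstBoundedBy m
  | and φ ψ => φ.ConstBoundedBy m ∧ ψ.ConstBoundedBy m
  | or φ ψ => φ.ConstBoundedBy m ∧ ψ.ConstBoundedBy m

/-- The set of clock valuations (which are nonnegative) that satisfy the constraint. -/
def sem (φ : Constraint X) : Set (X → ℝ) :=
  {v | (∀ x, 0 ≤ v x) ∧ φ.Sat v}

end Constraint

/-- `k,m`-regions: the minimal nonempty sets of valuations of `k` clocks that are definable by a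
constraint whose constants have absolute value at most `m`. -/
def IsRegion (k m : ℕ) (R : Set (Fin k → ℝ)) : Prop :=
  (∃ φ : Constraint (Fin k), φ.ConstBoundedBy m ∧ φ.sem = R) ∧ R.Nonempty ∧
    ∀ ψ : Constraint (Fin k), ψ.ConstBoundedBy m → ψ.sem.Nonempty → ¬ ψ.sem ⊂ R

/-- The number of `k,m`-regions. -/
noncomputable def regCount (k m : ℕ) : ℕ :=
  Set.ncard {R : Set (Fin k → ℝ) | IsRegion k m R}

/-- There are finitely many `k,m`-regions, so that `regCount` is a genuine count. -/
theorem finite_regions (k m : ℕ) : {R : Set (Fin k → ℝ) | IsRegion k m R}.Finite := by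
  classical
  let I := ↥(Finset.Icc (-(m : ℤ)) m)
  let sig : (Fin k → ℝ) → (Fin k × Fin k × Cmp × I → Prop) × (Fin k × Cmp × I → Prop) :=
    fun v => (fun a => a.2.2.1.holds (v a.1 - v a.2.1) (a.2.2.2 : ℤ),
      fun a => a.2.1.holds (v a.1) (a.2.2 : ℤ))
  have key : ∀ u v, sig u = sig v → ∀ φ : Constraint (Fin k), φ.ConstBoundedBy m →
      (φ.Sat u ↔ φ.Sat v) := by
    intro u v huv φ
    induction φ with
    | tt => intro _; rfl
    | ff => intro _; rfl
    | diff x y c z =>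
      intro hz
      have hz' : z ∈ Finset.Icc (-(m : ℤ)) m := Finset.mem_Icc.2 (abs_le.1 hz)
      exact iff_of_eq (congrFun (congrArg Prod.fst huv) (x, y, c, ⟨z, hz'⟩))
    | clock x c z =>
      intro hz
      have hz' : z ∈ Finset.Icc (-(m : ℤ)) m := Finset.mem_Icc.2 (abs_le.1 hz)
      exact iff_of_eq (congrFun (congrArg Prod.snd huv) (x, c, ⟨z, hz'⟩))
    | not φ ih => intro h; exact not_congr (ih h)
    | and φ ψ ih1 ih2 => intro h; exact and_congr (ih1 h.1) (ih2 h.2)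
    | or φ ψ ih1 ih2 => intro h; exact or_congr (ih1 h.1) (ih2 h.2)
  let f : Set (Fin k → ℝ) → (Fin k × Fin k × Cmp × I → Prop) × (Fin k × Cmp × I → Prop) :=
    fun R => if h : R.Nonempty then sig h.some else sig 0
  refine Set.Finite.of_finite_image (f := f) (Set.toFinite _) ?_
  rintro R ⟨⟨φ, hφ, rfl⟩, hR, hRmin⟩ R' ⟨⟨φ', hφ', rfl⟩, hR', hRmin'⟩ hf
  simp only [f, dif_pos hR, dif_pos hR'] at hf
  have hand : (Constraint.and φ φ').sem = φ.sem ∩ φ'.sem := by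
    ext v; simp only [Constraint.sem, Constraint.Sat, Set.mem_ofPred_eq, Set.mem_inter_iff]; tauto
  have hne : (Constraint.and φ φ').sem.Nonempty := by
    rw [hand]
    exact ⟨hR.some, hR.some_mem, hR.some_mem.1, (key _ _ hf φ' hφ').2 hR'.some_mem.2⟩
  have h1 := hRmin (.and φ φ') ⟨hφ, hφ'⟩ hne
  have h2 := hRmin' (.and φ φ') ⟨hφ, hφ'⟩ hne
  rw [hand] at h1 h2
  have e1 : φ.sem ∩ φ'.sem = φ.sem := by
    by_contra h; exact h1 (lt_of_le_of_ne Set.inter_subset_left h)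
  have e2 : φ.sem ∩ φ'.sem = φ'.sem := by
    by_contra h; exact h2 (lt_of_le_of_ne Set.inter_subset_right h)
  exact e1.symm.trans e2

/-! Timed automata -/

/-- A transition rule. -/
structure Rule (Alph X Loc : Type*) where
  source : Loc
  letter : Alph
  guard : Constraint X
  resets : Set X
  target : Loc

/-- A nondeterministic timed automaton (without epsilon transitions) with alphabet `Alph`, clocks
`X` and locations `Loc`, all three of which are finite types wherever automata are used. -/
structure TimedAutomaton (Alph X Loc : Type*) where
  init : Set Loc
  final : Set Loc
  rules : Set (Rule Alph X Loc)
  rules_finite : rules.Finite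

/-- A configuration: a location, a reset-point assignment and the current time. -/
structure Config (X Loc : Type*) where
  loc : Loc
  reset : X → ℝ
  now : ℝ
  now_nonneg : 0 ≤ now
  reset_nonneg : ∀ x, 0 ≤ reset x
  reset_le_now : ∀ x, reset x ≤ now

namespace TimedAutomaton

variable {Alph X Loc : Type*} (A : TimedAutomaton Alph X Loc)

/-- All constants in the guards of `A` have absolute value at most `m`. -/
def ConstBoundedBy (m : ℕ) : Prop :=
  ∀ r ∈ A.rules, r.guard.ConstBoundedBy m

/-- Every transition rule resets some clock. -/
def AlwaysResetting : Prop :=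
  ∀ r ∈ A.rules, r.resets.Nonempty

/-- Exactly one initial location, and any two rules with the same source, the same letter and
jointly satisfiable guards have the same resets and the same target. -/
def Deterministic : Prop :=
  (∃! p, p ∈ A.init) ∧
    ∀ r ∈ A.rules, ∀ r' ∈ A.rules, r.source = r'.source → r.letter = r'.letter →
      (Constraint.and r.guard r'.guard).sem.Nonempty →
        r.resets = r'.resets ∧ r.target = r'.target

/-- Transitions of the reset-point semantics, labelled by a letter and a timestamp. The guard is
evaluated at the clock values at time `t`, before the resets. -/
def Step (c : Config X Loc) (σ : Alph) (t : ℝ) (c' : Config X Loc) : Prop :=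
  c.now ≤ t ∧ c'.now = t ∧
    ∃ r ∈ A.rules, r.source = c.loc ∧ r.letter = σ ∧ r.target = c'.loc ∧
      r.guard.Sat (fun x => t - c.reset x) ∧
      (∀ x ∈ r.resets, c'.reset x = t) ∧ (∀ x ∉ r.resets, c'.reset x = c.reset x)

/-- There is an accepting run over the given word starting in the given configuration. -/
def HasAcceptingRun : Config X Loc → List (Alph × ℝ) → Prop
  | c, [] => c.loc ∈ A.final
  | c, a :: w => ∃ c', A.Step c a.1 a.2 c' ∧ HasAcceptingRun c' w

/-- Initial configurations: an initial location, time `0`, all clocks reset at `0`. -/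
def IsInitial (c : Config X Loc) : Prop :=
  c.loc ∈ A.init ∧ c.now = 0 ∧ ∀ x, c.reset x = 0

/-- The timed language recognised by `A`. -/
def language : Set (List (Alph × ℝ)) :=
  {w | IsTimedWord w ∧ ∃ c, A.IsInitial c ∧ A.HasAcceptingRun c w}

end TimedAutomaton

end Timed

/-! From 1 to 2: a deterministic automaton has at most one configuration after a word. An
automorphism that fixes its reset points carries accepting runs from it to accepting runs from it,
so these at most k points support the quotient; always resetting puts the last timestamp among them.

From 2 to 3: supports with a common base point are closed under intersection modulo the integers
(`Supports.inter`), so each quotient has a least support, `core`. The k clocks of the new automaton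
store it, each class by its latest timestamp (`Tracks`), and every clock without a needed point of
its own is reset. Some clock always is: otherwise k stored classes and the class of the new time
would all lie in a support of size k (`Tracks.resetSet_nonempty`).

States are similar if one timed automorphism matches both their clocks and their quotients. Reading
a letter at region equivalent times preserves similarity (`Similar.congr`), so similarity classes
with regions as guards give a deterministic automaton. The crux is that moving the reading time
inside a region changes the quotient only by an automorphism (`exists_transport`).

It remains to count classes. Stored points are at most m old (`Tracks.ge`), so the region of the
clock values suffices to align the clocks of two states (`exists_align_of_sub_lt_iff`). After
alignment the quotient depends only on the locations of `A` reached, each with the position of its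
clock among the integer translates of the stored points in [l − m, l], where l is the last timestamp
(`similar_of_positions`). There are at most km + 1 translates, hence 2km + 2 positions, one more
than allowed if m ≥ 1. When all occur, a generic choice of the representing word
(`exists_similar_isSparse`) leaves empty either the point l − m or the gap just before l. Which of
the two is dropped is recorded in the region, by shifting all clock values by one, so it costs no
extra factor. For m = 0 the only translate is l, and two positions are allowed. -/

namespace Timed

/-! ### Congruence modulo the integers -/

/-- Two reals that differ by an integer. -/
def ZEq (a b : ℝ) : Prop := ∃ z : ℤ, a = b + z

theorem ZEq.refl (a : ℝ) : ZEq a a := ⟨0, by simp⟩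

theorem ZEq.symm {a b : ℝ} : ZEq a b → ZEq b a := by
  rintro ⟨z, rfl⟩; exact ⟨-z, by push_cast; ring⟩

theorem ZEq.trans {a b c : ℝ} : ZEq a b → ZEq b c → ZEq a c := by
  rintro ⟨z, rfl⟩ ⟨y, rfl⟩; exact ⟨y + z, by push_cast; ring⟩

/-! ### Timed automorphisms -/

namespace IsTimedAutomorphism

variable {π ρ : ℝ ≃o ℝ}

theorem map_add_nat (h : IsTimedAutomorphism π) (a : ℝ) (n : ℕ) : π (a + n) = π a + n := by
  induction n with
  | zero => simp
  | succ n ih => push_cast; rw [← add_assoc, h, ih, add_assoc]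

theorem map_add_int (h : IsTimedAutomorphism π) (a : ℝ) (z : ℤ) : π (a + z) = π a + z := by
  obtain ⟨n, rfl | rfl⟩ := z.eq_nat_or_neg
  · exact_mod_cast h.map_add_nat a n
  · have := h.map_add_nat (a + ((-(n : ℤ) : ℤ) : ℝ)) n
    push_cast at this ⊢
    rw [neg_add_cancel_right] at this
    linarith

theorem symm (h : IsTimedAutomorphism π) : IsTimedAutomorphism π.symm := fun a => by
  apply π.injective
  rw [h]; simp

theorem trans (h : IsTimedAutomorphism π) (h' : IsTimedAutomorphism ρ) :
    IsTimedAutomorphism (π.trans ρ) := fun a => by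
  simp [h a, h' (π a)]

theorem refl : IsTimedAutomorphism (OrderIso.refl ℝ) := fun a => by simp

theorem zeq_iff (h : IsTimedAutomorphism π) {a b : ℝ} : ZEq (π a) (π b) ↔ ZEq a b := by
  constructor
  · rintro ⟨z, hz⟩
    rw [← h.map_add_int] at hz
    exact ⟨z, π.injective hz⟩
  · rintro ⟨z, rfl⟩
    exact ⟨z, h.map_add_int b z⟩

theorem sub_lt_iff (h : IsTimedAutomorphism π) (a b : ℝ) (z : ℤ) :
    π a - π b < z ↔ a - b < z := by
  rw [sub_lt_iff_lt_add', sub_lt_iff_lt_add', ← h.map_add_int, π.lt_iff_lt]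

theorem lt_sub_iff (h : IsTimedAutomorphism π) (a b : ℝ) (z : ℤ) :
    z < π a - π b ↔ z < a - b := by
  rw [lt_sub_iff_add_lt', lt_sub_iff_add_lt', ← h.map_add_int, π.lt_iff_lt]

end IsTimedAutomorphism

theorem exists_translation (a b : ℝ) : ∃ π : ℝ ≃o ℝ, IsTimedAutomorphism π ∧ π a = b :=
  ⟨OrderIso.addRight (b - a), fun x => by simp; ring, by simp⟩

/-- A timed automorphism supported on the integer translates of an interval `(c, d)` of length at
most one that moves `a` up to `b`. -/
theorem exists_bump {a b c d : ℝ} (hca : c < a) (hab : a ≤ b) (hbd : b < d) (hdc : d ≤ c + 1) :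
    ∃ π : ℝ ≃o ℝ, IsTimedAutomorphism π ∧ π a = b ∧
      ∀ x, (∀ z : ℤ, ¬ (c < x + z ∧ x + z < d)) → π x = x := by
  have hac : 0 < a - c := by linarith
  have hbc : 0 < b - c := by linarith
  have hda : 0 < d - a := by linarith
  have hdb : 0 < d - b := by linarith
  let p := (b - c) / (a - c)
  let q := (d - b) / (d - a)
  have hp : 0 < p := div_pos hbc hac
  have hq : 0 < q := div_pos hdb hda
  have hp1 : 1 ≤ p := (one_le_div hac).2 (by linarith)
  have hq1 : q ≤ 1 := (div_le_one hda).2 (by linarith)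
  -- The two lines join (c, c) and (d, d) to (a, b), with slopes p ≥ 1 and q ≤ 1. Outside [c, d] one
  -- of them is at most the diagonal, so there the maximum is x.
  let f : ℝ → ℝ := fun x => max x (min (c + (x - c) * p) (d - (d - x) * q))
  have hfm : StrictMono f := by
    intro x y hxy
    apply max_lt_max hxy
    apply min_lt_min
    · have := mul_lt_mul_of_pos_right (show x - c < y - c by linarith) hp
      linarith
    · have := mul_lt_mul_of_pos_right (show d - y < d - x by linarith) hq
      linarith
  have hfc : Continuous f := by fun_prop
  have hfd : ∀ x, d ≤ x → f x = x := by
    intro x hx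
    apply max_eq_left
    apply (min_le_right _ _).trans
    nlinarith
  have hf0 : f c = c := by
    apply max_eq_left
    apply (min_le_left _ _).trans
    simp
  have hf1 : f (c + 1) = c + 1 := hfd _ hdc
  have hfa : f a = b := by
    have h1 : c + (a - c) * p = b := by simp only [p]; field_simp; ring
    have h2 : d - (d - a) * q = b := by simp only [q]; field_simp; ring
    simp only [f, h1, h2, min_self, max_eq_right hab]
  -- Both c and c + 1 are fixed by `f`, since d ≤ c + 1, so `f` on [c, c + 1] extends periodically.
  let h : ℝ → ℝ := fun x => f (x - ⌊x - c⌋) + ⌊x - c⌋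
  have hlo : ∀ x : ℝ, c ≤ x - ⌊x - c⌋ := fun x => by linarith [Int.floor_le (x - c)]
  have hhi : ∀ x : ℝ, x - ⌊x - c⌋ < c + 1 := fun x => by linarith [Int.lt_floor_add_one (x - c)]
  have hm : StrictMono h := by
    intro x y hxy
    have hle : ⌊x - c⌋ ≤ ⌊y - c⌋ := Int.floor_le_floor (by linarith)
    rcases hle.eq_or_lt with e | e
    · simp only [h, e]
      have := hfm (show x - (⌊y - c⌋ : ℝ) < y - ⌊y - c⌋ by linarith)
      linarith
    · have e' : (⌊x - c⌋ : ℝ) + 1 ≤ ⌊y - c⌋ := by exact_mod_cast e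
      have h1 := hfm (hhi x)
      have h2 := hfm.monotone (hlo y)
      simp only [h]
      linarith
  have hs : Function.Surjective h := by
    intro y
    have hy : y - ⌊y - c⌋ ∈ Set.Icc (f c) (f (c + 1)) := by
      rw [hf0, hf1]; exact ⟨hlo y, (hhi y).le⟩
    obtain ⟨x, ⟨hx1, -⟩, hx⟩ :=
      intermediate_value_Icc (show c ≤ c + 1 by linarith) hfc.continuousOn hy
    have hx2 : x < c + 1 := by
      rw [← hfm.lt_iff_lt, hx, hf1]; exact hhi y
    refine ⟨x + ⌊y - c⌋, ?_⟩
    have e : ⌊x + (⌊y - c⌋ : ℝ) - c⌋ = ⌊y - c⌋ := by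
      rw [Int.floor_eq_iff]; constructor <;> linarith
    simp only [h, e, add_sub_cancel_right, hx, sub_add_cancel]
  refine ⟨hm.orderIsoOfSurjective h hs, ?_, ?_, ?_⟩
  · intro x
    change h (x + 1) = h x + 1
    have e : ⌊x + 1 - c⌋ = ⌊x - c⌋ + 1 := by
      rw [show x + 1 - c = x - c + 1 by ring, Int.floor_add_one]
    simp only [h, e]; push_cast
    rw [show x + 1 - ((⌊x - c⌋ : ℝ) + 1) = x - ⌊x - c⌋ by ring]; ring
  · change h a = b
    have e : ⌊a - c⌋ = 0 := by
      rw [Int.floor_eq_iff]; constructor <;> push_cast <;> linarith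
    simp [h, e, hfa]
  · intro x hx
    change h x = x
    have h1 := hx (-⌊x - c⌋)
    push_cast at h1
    rw [← sub_eq_add_neg] at h1
    have : f (x - ⌊x - c⌋) = x - ⌊x - c⌋ := by
      rcases (hlo x).eq_or_lt with e | e
      · rw [← e, hf0]
      · exact hfd _ (by by_contra hc; exact h1 ⟨e, not_le.1 hc⟩)
    simp only [h, this]; ring

/-- Points of the same arc can be moved to each other by timed automorphisms fixing the ends. -/
theorem exists_move_of_le {P : Finset ℝ} (hP : P.Nonempty) {a b : ℝ} (hab : a ≤ b)
    (h : ∀ p ∈ P, ∀ z : ℤ, a ≤ p + z → ¬ p + z ≤ b) :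
    ∃ π : ℝ ≃o ℝ, IsTimedAutomorphism π ∧ (∀ p ∈ P, π p = p) ∧ π a = b := by
  -- The bump lives between the last translate of `P` before a and the first one after b. They are
  -- at most 1 apart, since the former plus 1 is a translate beyond b.
  obtain ⟨p, hp, hpm⟩ := P.exists_max_image (fun p => p + (⌈a - p⌉ - 1 : ℝ)) hP
  obtain ⟨q, hq, hqm⟩ := P.exists_min_image (fun p => p + (⌊b - p⌋ + 1 : ℝ)) hP
  have h1 : p + (⌈a - p⌉ - 1 : ℝ) < a := by linarith [Int.ceil_lt_add_one (a - p)]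
  have h2 : b < q + (⌊b - q⌋ + 1 : ℝ) := by linarith [Int.lt_floor_add_one (b - q)]
  have h3 : q + (⌊b - q⌋ + 1 : ℝ) ≤ p + (⌈a - p⌉ - 1 : ℝ) + 1 := by
    refine (hqm p hp).trans ?_
    have : ⌊b - p⌋ < ⌈a - p⌉ := by
      by_contra hc
      push Not at hc
      apply h p hp ⌊b - p⌋
      · have : (⌈a - p⌉ : ℝ) ≤ ⌊b - p⌋ := by exact_mod_cast hc
        linarith [Int.le_ceil (a - p)]
      · linarith [Int.floor_le (b - p)]
    have : (⌊b - p⌋ : ℝ) + 1 ≤ ⌈a - p⌉ := by exact_mod_cast this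
    linarith
  obtain ⟨π, hπ, hπa, hπf⟩ := exists_bump h1 hab h2 h3
  refine ⟨π, hπ, fun x hx => hπf x ?_, hπa⟩
  rintro z ⟨hz1, hz2⟩
  have e1 := hpm x hx
  have e2 := hqm x hx
  apply h x hx z
  · have : ((⌈a - x⌉ - 1 : ℤ) : ℝ) < z := by push_cast; linarith
    have : ⌈a - x⌉ ≤ z := by have := Int.cast_lt.1 this; omega
    linarith [Int.ceil_le.1 this]
  · have : (z : ℝ) < ((⌊b - x⌋ + 1 : ℤ) : ℝ) := by push_cast; linarith
    have : z ≤ ⌊b - x⌋ := by have := Int.cast_lt.1 this; omega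
    linarith [Int.le_floor.1 this]

theorem exists_move {P : Finset ℝ} (hP : P.Nonempty) {a b : ℝ}
    (h : ∀ p ∈ P, ∀ z : ℤ, min a b ≤ p + z → ¬ p + z ≤ max a b) :
    ∃ π : ℝ ≃o ℝ, IsTimedAutomorphism π ∧ (∀ p ∈ P, π p = p) ∧ π a = b := by
  rcases le_total a b with hab | hab
  · rw [min_eq_left hab, max_eq_right hab] at h
    exact exists_move_of_le hP hab h
  · rw [min_eq_right hab, max_eq_left hab] at h
    obtain ⟨π, hπ, hf, hb⟩ := exists_move_of_le hP hab h
    exact ⟨π.symm, hπ.symm, fun p hp => by rw [OrderIso.symm_apply_eq, hf p hp],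
      by rw [OrderIso.symm_apply_eq, hb]⟩

/-- Finitely many integer translation classes avoid a left neighbourhood of a point outside. -/
theorem exists_lt_avoiding (P : Finset ℝ) {s : ℝ} (h : ∀ p ∈ P, ¬ ZEq s p) :
    ∃ s' < s, ∀ p ∈ P, ∀ z : ℤ, s' ≤ p + z → ¬ p + z ≤ s := by
  rcases P.eq_empty_or_nonempty with rfl | hP
  · exact ⟨s - 1, by linarith, by simp⟩
  obtain ⟨p, hp, hpm⟩ := P.exists_max_image (fun p => p + (⌊s - p⌋ : ℝ)) hP
  have h1 : p + (⌊s - p⌋ : ℝ) < s := by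
    refine lt_of_le_of_ne (by linarith [Int.floor_le (s - p)]) ?_
    intro e
    exact h p hp ⟨_, e.symm⟩
  obtain ⟨s', hs1, hs2⟩ := exists_between h1
  refine ⟨s', hs2, fun q hq z hz1 hz2 => ?_⟩
  have : z ≤ ⌊s - q⌋ := Int.le_floor.2 (by linarith)
  have : (z : ℝ) ≤ ⌊s - q⌋ := by exact_mod_cast this
  linarith [hpm q hq]

/-! ### Invariance and least supports -/

section Invariance

variable {Alph : Type*}

theorem mapWord_trans (π ρ : ℝ ≃o ℝ) (v : List (Alph × ℝ)) :
    mapWord (π.trans ρ) v = mapWord ρ (mapWord π v) := by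
  simp [mapWord]

theorem mapWord_symm_mapWord (π : ℝ ≃o ℝ) (v : List (Alph × ℝ)) :
    mapWord π.symm (mapWord π v) = v := by
  simp [mapWord, Function.comp_def]

theorem mapWord_mapWord_symm (π : ℝ ≃o ℝ) (v : List (Alph × ℝ)) :
    mapWord π (mapWord π.symm v) = v := by
  simp [mapWord, Function.comp_def]

theorem mapWord_cons (π : ℝ → ℝ) (a : Alph × ℝ) (v : List (Alph × ℝ)) :
    mapWord π (a :: v) = (a.1, π a.2) :: mapWord π v := rfl

/-- Invariance of a set of words under all timed automorphisms that fix `S` pointwise. -/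
def Supports (S : Set ℝ) (L : Set (List (Alph × ℝ))) : Prop :=
  ∀ π : ℝ ≃o ℝ, IsTimedAutomorphism π → (∀ s ∈ S, π s = s) → ∀ v, v ∈ L ↔ mapWord π v ∈ L

variable {L : Set (List (Alph × ℝ))}

theorem supports_of_forall_mem {S : Set ℝ}
    (h : ∀ π : ℝ ≃o ℝ, IsTimedAutomorphism π → (∀ s ∈ S, π s = s) → ∀ v ∈ L, mapWord π v ∈ L) :
    Supports S L := fun π hπ hf v => by
  refine ⟨h π hπ hf v, fun hv => ?_⟩
  rw [← mapWord_symm_mapWord π v]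
  exact h π.symm hπ.symm (fun s hs => by rw [OrderIso.symm_apply_eq, hf s hs]) _ hv

theorem Supports.mono {S T : Set ℝ} (h : ∀ s ∈ S, ∃ t ∈ T, ZEq s t) (hS : Supports S L) :
    Supports T L := fun π hπ hf v => hS π hπ (fun s hs => by
  obtain ⟨t, ht, z, rfl⟩ := h s hs
  rw [hπ.map_add_int, hf t ht]) v

theorem Supports.subset {S T : Set ℝ} (hS : Supports S L) (h : S ⊆ T) : Supports T L :=
  hS.mono fun s hs => ⟨s, h hs, ZEq.refl s⟩

theorem Supports.image {S : Set ℝ} (hS : Supports S L) {π : ℝ ≃o ℝ} (hπ : IsTimedAutomorphism π)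
    {L' : Set (List (Alph × ℝ))} (hL : ∀ v, v ∈ L ↔ mapWord π v ∈ L') : Supports (π '' S) L' := by
  intro ρ hρ hf v
  have h1 := hL (mapWord π.symm v)
  have h2 := hS ((π.trans ρ).trans π.symm) ((hπ.trans hρ).trans hπ.symm)
    (fun s hs => by simp [hf (π s) ⟨s, hs, rfl⟩]) (mapWord π.symm v)
  have h3 := hL (mapWord ((π.trans ρ).trans π.symm) (mapWord π.symm v))
  rw [mapWord_mapWord_symm] at h1
  rw [mapWord_trans, mapWord_trans, mapWord_mapWord_symm, mapWord_mapWord_symm] at h3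
  rw [mapWord_trans, mapWord_trans, mapWord_mapWord_symm] at h2
  rw [← h1, h2, h3]

/-- Let `π` fix the rest of `S`, with s ≤ π s. As `s` has no counterpart in `T`, an automorphism
fixing `T` and the rest of `S` relates `s` to a slightly earlier s', so `S` with `s` replaced by s'
is also a support. An automorphism `ρ` fixing this second support can already move `s` to π s, and
`π` followed by the inverse of `ρ` fixes all of `S`. -/
theorem Supports.erase {S T : Finset ℝ} (hS : Supports (S : Set ℝ) L)
    (hT : Supports (T : Set ℝ) L) {s t₀ : ℝ} (hsT : ∀ t ∈ T, ¬ ZEq s t)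
    (h0S : t₀ ∈ S) (h0T : t₀ ∈ T) : Supports ((S.erase s : Finset ℝ) : Set ℝ) L := by
  classical
  by_cases hdup : ∃ t ∈ S.erase s, ZEq s t
  · refine hS.mono fun x hx => ?_
    by_cases hxs : x = s
    · subst hxs; exact hdup
    · exact ⟨x, Finset.mem_coe.2 (Finset.mem_erase.2 ⟨hxs, hx⟩), ZEq.refl x⟩
  push Not at hdup
  have h0 : t₀ ∈ S.erase s := Finset.mem_erase.2 ⟨fun e => hsT t₀ h0T (e ▸ ZEq.refl _), h0S⟩
  have key : ∀ π : ℝ ≃o ℝ, IsTimedAutomorphism π → (∀ p ∈ S.erase s, π p = p) → s ≤ π s →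
      ∀ v, v ∈ L ↔ mapWord π v ∈ L := by
    intro π hπ hf hle v
    obtain ⟨s', hs', hav⟩ := exists_lt_avoiding (T ∪ S.erase s) (s := s) (by
      intro p hp
      rcases Finset.mem_union.1 hp with hp | hp
      exacts [hsT p hp, hdup p hp])
    obtain ⟨τ, hτ, hτf, hτs⟩ := exists_move_of_le (P := T ∪ S.erase s)
      ⟨t₀, Finset.mem_union_left _ h0T⟩ hs'.le hav
    -- Some translate of t₀ lies in (s, s' + 1]. It is fixed by `π`, so π s stays below it.
    have hlt : π s < s' + 1 := by
      have e1 := hav t₀ (Finset.mem_union_left _ h0T) ⌊s' - t₀⌋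
      have e2 := hav t₀ (Finset.mem_union_left _ h0T) (⌊s' - t₀⌋ + 1)
      have f1 := Int.floor_le (s' - t₀)
      have f2 := Int.lt_floor_add_one (s' - t₀)
      push_cast at e2
      have e3 : s < t₀ + ((⌊s' - t₀⌋ + 1 : ℤ) : ℝ) := by
        push_cast; exact not_le.1 (e2 (by linarith))
      have e4 := π.strictMono e3
      rw [hπ.map_add_int, hf t₀ h0] at e4
      push_cast at e4
      linarith
    obtain ⟨ρ, hρ, hρf, hρs⟩ := exists_move_of_le (P := insert s' (S.erase s))
      ⟨s', Finset.mem_insert_self _ _⟩ hle (by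
        intro p hp z hz1 hz2
        rcases Finset.mem_insert.1 hp with rfl | hp
        · have z1 : (0 : ℝ) < z := by linarith
          have z2 : (z : ℝ) < 1 := by linarith
          have z1 : 0 < z := by exact_mod_cast z1
          have z2 : z < 1 := by exact_mod_cast z2
          omega
        · have : s < p + z := lt_of_le_of_ne hz1 fun e => hdup p hp ⟨z, e⟩
          have := π.strictMono this
          rw [hπ.map_add_int, hf p hp] at this
          linarith)
    have hρL : ∀ v, v ∈ L ↔ mapWord ρ v ∈ L := by
      have hτL : ∀ v, v ∈ L ↔ mapWord τ.symm v ∈ L := hT τ.symm hτ.symm fun t ht => by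
        rw [OrderIso.symm_apply_eq, hτf t (Finset.mem_union_left _ ht)]
      refine hS.image hτ.symm hτL ρ hρ ?_
      rintro _ ⟨x, hx, rfl⟩
      by_cases hxs : x = s
      · rw [hxs, ← hτs, OrderIso.symm_apply_apply]
        exact hρf _ (Finset.mem_insert_self _ _)
      · have hx' : x ∈ S.erase s := Finset.mem_erase.2 ⟨hxs, hx⟩
        have : τ.symm x = x := by
          rw [OrderIso.symm_apply_eq, hτf x (Finset.mem_union_right _ hx')]
        rw [this]
        exact hρf _ (Finset.mem_insert_of_mem hx')
    have hκ := hS (π.trans ρ.symm) (hπ.trans hρ.symm) (fun x hx => by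
      by_cases hxs : x = s
      · subst hxs; simp [← hρs]
      · have hx' : x ∈ S.erase s := Finset.mem_erase.2 ⟨hxs, hx⟩
        simp only [OrderIso.trans_apply]
        rw [hf x hx', OrderIso.symm_apply_eq, hρf _ (Finset.mem_insert_of_mem hx')]) v
    rw [hκ, hρL, mapWord_trans, mapWord_mapWord_symm]
  intro π hπ hf v
  rcases le_total s (π s) with hle | hle
  · exact key π hπ hf hle v
  · have := key π.symm hπ.symm (fun p hp => by rw [OrderIso.symm_apply_eq, hf p hp])
      (by rw [← π.symm.le_iff_le] at hle; simpa using hle) (mapWord π v)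
    rw [mapWord_symm_mapWord] at this
    exact this.symm

/-- Points of `S` without a counterpart in `T` are erased one by one; the base point is never among
them. -/
theorem Supports.inter {S T : Finset ℝ} (hS : Supports (S : Set ℝ) L)
    (hT : Supports (T : Set ℝ) L) {t₀ : ℝ} (h0S : t₀ ∈ S) (h0T : t₀ ∈ T) :
    Supports {s | s ∈ S ∧ ∃ t ∈ T, ZEq s t} L := by
  induction h : S.card generalizing S with
  | zero => rw [Finset.card_eq_zero] at h; simp [h] at h0S
  | succ n ih =>
    by_cases hbad : ∃ s ∈ S, ∀ t ∈ T, ¬ ZEq s t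
    · obtain ⟨s, hs, hsT⟩ := hbad
      have h0 : t₀ ∈ S.erase s := Finset.mem_erase.2 ⟨fun e => hsT t₀ h0T (e ▸ ZEq.refl _), h0S⟩
      refine (ih (hS.erase hT hsT h0S h0T) h0 (by rw [Finset.card_erase_of_mem hs]; omega)).subset ?_
      rintro x ⟨hx, hx'⟩
      exact ⟨Finset.mem_of_mem_erase hx, hx'⟩
    · push Not at hbad
      exact hS.subset fun s hs => ⟨hs, hbad s hs⟩

/-- The least support, as a set closed under integer translations: the points that are congruent to
a member of every finite support containing the base point `t₀`. -/
def core (L : Set (List (Alph × ℝ))) (t₀ : ℝ) : Set ℝ :=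
  {a | ∀ S : Finset ℝ, t₀ ∈ S → Supports (S : Set ℝ) L → ∃ s ∈ S, ZEq a s}

theorem self_mem_core (t₀ : ℝ) : t₀ ∈ core L t₀ := fun _ h _ => ⟨t₀, h, ZEq.refl _⟩

theorem mem_core_of_zeq {t₀ a b : ℝ} (h : ZEq a b) (hb : b ∈ core L t₀) : a ∈ core L t₀ :=
  fun S hS hL => by
    obtain ⟨s, hs, hbs⟩ := hb S hS hL
    exact ⟨s, hs, h.trans hbs⟩

/-- Every finite support contains a finite support inside the core. -/
theorem exists_support_subset_core {T : Finset ℝ} (hT : Supports (T : Set ℝ) L) {t₀ : ℝ}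
    (h0 : t₀ ∈ T) : ∃ F ⊆ T, Supports (F : Set ℝ) L ∧ (F : Set ℝ) ⊆ core L t₀ := by
  classical
  obtain ⟨F, hF, hmin⟩ := Finset.exists_min_image
    (T.powerset.filter fun F : Finset ℝ => t₀ ∈ F ∧ Supports (F : Set ℝ) L) Finset.card
    ⟨T, by simp [h0, hT]⟩
  simp only [Finset.mem_filter, Finset.mem_powerset] at hF hmin
  refine ⟨F, hF.1, hF.2.2, fun f hf S h0S hS => ?_⟩
  -- `F` has least cardinality, so intersecting it with any other support loses no point.
  have h1 := hF.2.2.inter hS hF.2.1 h0S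
  have h2 := hmin (F.filter fun s => ∃ t ∈ S, ZEq s t)
    ⟨(Finset.filter_subset _ _).trans hF.1, Finset.mem_filter.2 ⟨hF.2.1, t₀, h0S, ZEq.refl _⟩,
      by simpa using h1⟩
  have h3 := Finset.eq_of_subset_of_card_le (Finset.filter_subset _ _) h2
  rw [← h3] at hf
  exact (Finset.mem_filter.1 hf).2

theorem supports_of_core_subset {T : Finset ℝ} (hT : Supports (T : Set ℝ) L) {t₀ : ℝ}
    (h0 : t₀ ∈ T) {S : Set ℝ} (h : ∀ a ∈ core L t₀, ∃ s ∈ S, ZEq a s) : Supports S L := by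
  obtain ⟨F, -, hF, hFc⟩ := exists_support_subset_core hT h0
  exact hF.mono fun f hf => h f (hFc hf)

/-- Automorphisms carry supports to supports, so the least support is equivariant. -/
theorem mem_core_image_iff {π : ℝ ≃o ℝ} (hπ : IsTimedAutomorphism π)
    {L' : Set (List (Alph × ℝ))} (hL : ∀ v, v ∈ L ↔ mapWord π v ∈ L') {t₀ a : ℝ} :
    π a ∈ core L' (π t₀) ↔ a ∈ core L t₀ := by
  classical
  have key : ∀ (π : ℝ ≃o ℝ) (_ : IsTimedAutomorphism π) (L L' : Set (List (Alph × ℝ)))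
      (_ : ∀ v, v ∈ L ↔ mapWord π v ∈ L') (t₀ a : ℝ),
      π a ∈ core L' (π t₀) → a ∈ core L t₀ := by
    intro π hπ L L' hL t₀ a h S h0 hS
    obtain ⟨s, hs, has⟩ := h (S.image π) (Finset.mem_image_of_mem _ h0)
      (by rw [Finset.coe_image]; exact hS.image hπ hL)
    obtain ⟨s', hs', rfl⟩ := Finset.mem_image.1 hs
    exact ⟨s', hs', hπ.zeq_iff.1 has⟩
  refine ⟨key π hπ L L' hL t₀ a, fun h => ?_⟩
  refine key π.symm hπ.symm L' L (fun v => by rw [hL, mapWord_mapWord_symm]) _ _ ?_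
  simpa using h

end Invariance
end Timed

namespace Timed

/-! ### Constraints -/

/-- Two valuations satisfy the same atomic constraints with constants bounded by `m`. -/
structure SameAtoms {X : Type*} (m : ℕ) (v v' : X → ℝ) : Prop where
  diff : ∀ x y (z : ℤ), |z| ≤ m → (v x - v y < z ↔ v' x - v' y < z)
  lt : ∀ x (z : ℤ), |z| ≤ m → (v x < z ↔ v' x < z)
  gt : ∀ x (z : ℤ), |z| ≤ m → (z < v x ↔ z < v' x)

namespace SameAtoms

variable {X : Type*} {m : ℕ} {v v' v'' : X → ℝ}

theorem symm (h : SameAtoms m v v') : SameAtoms m v' v :=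
  ⟨fun x y z hz => (h.diff x y z hz).symm, fun x z hz => (h.lt x z hz).symm,
    fun x z hz => (h.gt x z hz).symm⟩

theorem trans (h : SameAtoms m v v') (h' : SameAtoms m v' v'') : SameAtoms m v v'' :=
  ⟨fun x y z hz => (h.diff x y z hz).trans (h'.diff x y z hz),
    fun x z hz => (h.lt x z hz).trans (h'.lt x z hz),
    fun x z hz => (h.gt x z hz).trans (h'.gt x z hz)⟩

theorem diff_gt (h : SameAtoms m v v') (x y : X) (z : ℤ) (hz : |z| ≤ m) :
    z < v x - v y ↔ z < v' x - v' y := by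
  have := h.diff y x (-z) (by rwa [abs_neg])
  push_cast at this
  constructor <;> intro h
  · linarith [this.1 (by linarith)]
  · linarith [this.2 (by linarith)]

theorem le (h : SameAtoms m v v') (x : X) (z : ℤ) (hz : |z| ≤ m) : v x ≤ z ↔ v' x ≤ z := by
  rw [← not_lt, ← not_lt, h.gt x z hz]

theorem ge (h : SameAtoms m v v') (x : X) (z : ℤ) (hz : |z| ≤ m) : z ≤ v x ↔ z ≤ v' x := by
  rw [← not_lt, ← not_lt, h.lt x z hz]

end SameAtoms

theorem Cmp.holds_congr {a b : ℝ} {z : ℝ} (h1 : a < z ↔ b < z) (h2 : z < a ↔ z < b) (c : Cmp) :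
    c.holds a z ↔ c.holds b z := by
  cases c
  · simp only [Cmp.holds, le_antisymm_iff, ← not_lt, h1, h2]
  · exact h1
  · simp only [Cmp.holds, ← not_lt, h2]
  · exact h2
  · simp only [Cmp.holds, ge_iff_le, ← not_lt, h1]

theorem SameAtoms.sat_iff {X : Type*} {m : ℕ} {v v' : X → ℝ} (h : SameAtoms m v v')
    {φ : Constraint X} (hφ : φ.ConstBoundedBy m) : φ.Sat v ↔ φ.Sat v' := by
  induction φ with
  | tt => rfl
  | ff => rfl
  | diff x y c z => exact Cmp.holds_congr (h.diff x y z hφ) (h.diff_gt x y z hφ) c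
  | clock x c z => exact Cmp.holds_congr (h.lt x z hφ) (h.gt x z hφ) c
  | not φ ih => exact not_congr (ih hφ)
  | and φ ψ ih1 ih2 => exact and_congr (ih1 hφ.1) (ih2 hφ.2)
  | or φ ψ ih1 ih2 => exact or_congr (ih1 hφ.1) (ih2 hφ.2)

theorem Constraint.ConstBoundedBy.mono {X : Type*} {m m' : ℕ} (h : m ≤ m') {φ : Constraint X}
    (hφ : φ.ConstBoundedBy m) : φ.ConstBoundedBy m' := by
  have h' : (m : ℤ) ≤ m' := by exact_mod_cast h
  induction φ with
  | tt => trivial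
  | ff => trivial
  | diff x y c z => exact le_trans hφ h'
  | clock x c z => exact le_trans hφ h'
  | not φ ih => exact ih hφ
  | and φ ψ ih1 ih2 => exact ⟨ih1 hφ.1, ih2 hφ.2⟩
  | or φ ψ ih1 ih2 => exact ⟨ih1 hφ.1, ih2 hφ.2⟩

theorem Constraint.exists_constBoundedBy {X : Type*} (φ : Constraint X) :
    ∃ m, φ.ConstBoundedBy m := by
  induction φ with
  | tt => exact ⟨0, trivial⟩
  | ff => exact ⟨0, trivial⟩
  | diff x y c z => exact ⟨z.natAbs, by simp [ConstBoundedBy]⟩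
  | clock x c z => exact ⟨z.natAbs, by simp [ConstBoundedBy]⟩
  | not φ ih => exact ih
  | and φ ψ ih1 ih2 =>
    obtain ⟨m1, h1⟩ := ih1
    obtain ⟨m2, h2⟩ := ih2
    exact ⟨max m1 m2, h1.mono (le_max_left _ _), h2.mono (le_max_right _ _)⟩
  | or φ ψ ih1 ih2 =>
    obtain ⟨m1, h1⟩ := ih1
    obtain ⟨m2, h2⟩ := ih2
    exact ⟨max m1 m2, h1.mono (le_max_left _ _), h2.mono (le_max_right _ _)⟩

theorem IsTimedAutomorphism.sameAtoms {π : ℝ ≃o ℝ} (hπ : IsTimedAutomorphism π) {X : Type*} (m : ℕ)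
    (t : ℝ) (c : X → ℝ) : SameAtoms m (fun x => t - c x) (fun x => π t - π (c x)) where
  diff x y z _ := by
    have := hπ.sub_lt_iff (c y) (c x) z
    simp only [sub_sub_sub_cancel_left, this]
  lt x z _ := (hπ.sub_lt_iff _ _ z).symm
  gt x z _ := (hπ.lt_sub_iff _ _ z).symm

theorem IsTimedAutomorphism.sat_iff {π : ℝ ≃o ℝ} (hπ : IsTimedAutomorphism π) {X : Type*}
    (t : ℝ) (c : X → ℝ) (φ : Constraint X) :
    φ.Sat (fun x => t - c x) ↔ φ.Sat (fun x => π t - π (c x)) := by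
  obtain ⟨m, hm⟩ := φ.exists_constBoundedBy
  exact (hπ.sameAtoms m t c).sat_iff hm

/-! ### Timed words -/

section Words

variable {Alph : Type*}

/-- Time `0` and the timestamps of a word. -/
noncomputable def stamps (w : List (Alph × ℝ)) : Finset ℝ := (0 :: w.map Prod.snd).toFinset

theorem mem_stamps {w : List (Alph × ℝ)} {u : ℝ} : u ∈ stamps w ↔ u = 0 ∨ ∃ a ∈ w, a.2 = u := by
  simp [stamps]

theorem stamps_append_singleton (w : List (Alph × ℝ)) (a : Alph × ℝ) (u : ℝ) :
    u ∈ stamps (w ++ [a]) ↔ u ∈ stamps w ∨ u = a.2 := by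
  simp only [mem_stamps, List.mem_append, List.mem_singleton]
  constructor
  · rintro (h | ⟨b, hb | rfl, rfl⟩)
    exacts [Or.inl (Or.inl h), Or.inl (Or.inr ⟨b, hb, rfl⟩), Or.inr rfl]
  · rintro ((h | ⟨b, hb, rfl⟩) | rfl)
    exacts [Or.inl h, Or.inr ⟨b, Or.inl hb, rfl⟩, Or.inr ⟨a, Or.inr rfl, rfl⟩]

@[simp] theorem lastTime_nil : lastTime ([] : List (Alph × ℝ)) = 0 := rfl

@[simp] theorem lastTime_append_singleton (w : List (Alph × ℝ)) (a : Alph × ℝ) :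
    lastTime (w ++ [a]) = a.2 := by
  simp [lastTime, List.getLastD_eq_getLast?]

theorem lastTime_mem_stamps (w : List (Alph × ℝ)) : lastTime w ∈ stamps w := by
  induction w using List.reverseRecOn with
  | nil => simp [mem_stamps]
  | append_singleton w a _ => rw [lastTime_append_singleton, stamps_append_singleton]; simp

theorem IsTimedWord.nil : IsTimedWord ([] : List (Alph × ℝ)) := ⟨by simp, by simp⟩

theorem IsTimedWord.append_left {w v : List (Alph × ℝ)} (h : IsTimedWord (w ++ v)) :
    IsTimedWord w :=
  ⟨fun a ha => h.1 a (List.mem_append_left _ ha), (List.pairwise_append.1 h.2).1⟩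

theorem IsTimedWord.stamps_nonneg {w : List (Alph × ℝ)} (h : IsTimedWord w) {u : ℝ}
    (hu : u ∈ stamps w) : 0 ≤ u := by
  rcases mem_stamps.1 hu with rfl | ⟨a, ha, rfl⟩
  exacts [le_rfl, h.1 a ha]

theorem IsTimedWord.lastTime_nonneg {w : List (Alph × ℝ)} (h : IsTimedWord w) : 0 ≤ lastTime w :=
  h.stamps_nonneg (lastTime_mem_stamps w)

theorem IsTimedWord.stamps_le {w : List (Alph × ℝ)} (h : IsTimedWord w) {u : ℝ}
    (hu : u ∈ stamps w) : u ≤ lastTime w := by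
  rcases mem_stamps.1 hu with rfl | ⟨b, hb, rfl⟩
  · exact h.lastTime_nonneg
  induction w using List.reverseRecOn with
  | nil => simp at hb
  | append_singleton w a _ =>
    rw [lastTime_append_singleton]
    rcases List.mem_append.1 hb with hb | hb
    · exact (List.pairwise_append.1 h.2).2.2 b hb a (by simp)
    · rw [List.mem_singleton.1 hb]

theorem isTimedWord_append {w v : List (Alph × ℝ)} : IsTimedWord (w ++ v) ↔
    IsTimedWord w ∧ (∀ a ∈ v, lastTime w ≤ a.2) ∧ v.Pairwise (fun a b => a.2 ≤ b.2) := by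
  constructor
  · intro h
    refine ⟨h.append_left, fun a ha => ?_, (List.pairwise_append.1 h.2).2.1⟩
    rcases mem_stamps.1 (lastTime_mem_stamps w) with e | ⟨b, hb, e⟩
    · rw [e]; exact h.1 a (List.mem_append_right _ ha)
    · rw [← e]; exact (List.pairwise_append.1 h.2).2.2 b hb a ha
  · rintro ⟨hw, hl, hp⟩
    refine ⟨fun a ha => ?_, List.pairwise_append.2 ⟨hw.2, hp, fun a ha b hb => ?_⟩⟩
    · rcases List.mem_append.1 ha with ha | ha
      exacts [hw.1 a ha, hw.lastTime_nonneg.trans (hl a ha)]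
    · exact (hw.stamps_le (mem_stamps.2 (Or.inr ⟨a, ha, rfl⟩))).trans (hl b hb)

theorem isTimedWord_append_singleton {w : List (Alph × ℝ)} {a : Alph × ℝ} :
    IsTimedWord (w ++ [a]) ↔ IsTimedWord w ∧ lastTime w ≤ a.2 := by
  simp [isTimedWord_append]

theorem pairwise_mapWord {π : ℝ ≃o ℝ} {v : List (Alph × ℝ)} :
    (mapWord π v).Pairwise (fun a b => a.2 ≤ b.2) ↔ v.Pairwise (fun a b => a.2 ≤ b.2) := by
  simp [mapWord, List.pairwise_map]

theorem mem_leftQuotient {w v : List (Alph × ℝ)} {L : Set (List (Alph × ℝ))} :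
    v ∈ leftQuotient w L ↔ IsTimedWord (w ++ v) ∧ w ++ v ∈ L := by
  refine ⟨fun h => h.2, fun h => ⟨?_, h⟩⟩
  exact ⟨fun a ha => h.1.1 a (List.mem_append_right _ ha), (List.pairwise_append.1 h.1.2).2.1⟩

/-- On left quotients, invariance in the sense of partial actions and in the sense of total actions
agree, provided that the last timestamp is fixed. -/
theorem isInvariantUnder_leftQuotient_iff {w : List (Alph × ℝ)} {L : Set (List (Alph × ℝ))}
    {S : Set ℝ} (hw : IsTimedWord w) (hS : lastTime w ∈ S) :
    IsInvariantUnder S (leftQuotient w L) ↔ Supports S (leftQuotient w L) := by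
  constructor
  · intro h
    refine supports_of_forall_mem fun π hπ hf v hv => ?_
    refine (h π hπ hf v hv.1 ⟨?_, ?_⟩).1 hv
    · intro b hb
      obtain ⟨a, ha, rfl⟩ := List.mem_map.1 hb
      have := (isTimedWord_append.1 hv.2.1).2.1 a ha
      have := π.monotone this
      rw [hf _ hS] at this
      exact hw.lastTime_nonneg.trans this
    · exact pairwise_mapWord.2 hv.1.2
  · intro h π hπ hf v _ _
    exact h π hπ hf v

end Words

/-! ### Runs -/

namespace TimedAutomaton

variable {Alph X Loc : Type*}

open Classical in
/-- Reset of the clocks in `Y` at time `t`. -/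
noncomputable def upd (c : X → ℝ) (Y : Set X) (t : ℝ) : X → ℝ := fun x => if x ∈ Y then t else c x

theorem upd_of_mem {c : X → ℝ} {Y : Set X} {t : ℝ} {x : X} (h : x ∈ Y) : upd c Y t x = t := by
  simp [upd, h]

theorem upd_of_notMem {c : X → ℝ} {Y : Set X} {t : ℝ} {x : X} (h : x ∉ Y) :
    upd c Y t x = c x := by
  simp [upd, h]

theorem map_upd (f : ℝ → ℝ) (c : X → ℝ) (Y : Set X) (t : ℝ) :
    (fun x => f (upd c Y t x)) = upd (fun x => f (c x)) Y (f t) := by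
  funext x
  by_cases h : x ∈ Y <;> simp [upd, h]

/-- Paths between pairs of a location and an assignment of reset points. -/
def Path (A : TimedAutomaton Alph X Loc) :
    Loc → (X → ℝ) → List (Alph × ℝ) → Loc → (X → ℝ) → Prop
  | p, c, [], q, d => q = p ∧ d = c
  | p, c, a :: v, q, d => ∃ r ∈ A.rules, r.source = p ∧ r.letter = a.1 ∧
      r.guard.Sat (fun x => a.2 - c x) ∧ Path A r.target (upd c r.resets a.2) v q d

/-- Acceptance from a location and an assignment of reset points. -/
def Accepts (A : TimedAutomaton Alph X Loc) (p : Loc) (c : X → ℝ) (v : List (Alph × ℝ)) : Prop :=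
  ∃ q d, A.Path p c v q d ∧ q ∈ A.final

/-- Reachability from an initial configuration. -/
def Reach (A : TimedAutomaton Alph X Loc) (w : List (Alph × ℝ)) (p : Loc) (c : X → ℝ) : Prop :=
  ∃ p₀ ∈ A.init, A.Path p₀ (fun _ => 0) w p c

variable {A : TimedAutomaton Alph X Loc}

theorem path_append {p q : Loc} {c d : X → ℝ} {v v' : List (Alph × ℝ)} :
    A.Path p c (v ++ v') q d ↔ ∃ p' c', A.Path p c v p' c' ∧ A.Path p' c' v' q d := by
  induction v generalizing p c with
  | nil => simp [Path]
  | cons a v ih =>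
    simp only [List.cons_append, Path, ih]
    constructor
    · rintro ⟨r, hr, h1, h2, h3, p', c', h4, h5⟩
      exact ⟨p', c', ⟨r, hr, h1, h2, h3, h4⟩, h5⟩
    · rintro ⟨p', c', ⟨r, hr, h1, h2, h3, h4⟩, h5⟩
      exact ⟨r, hr, h1, h2, h3, p', c', h4, h5⟩

theorem reach_nil {p : Loc} {c : X → ℝ} : A.Reach [] p c ↔ p ∈ A.init ∧ c = fun _ => 0 := by
  constructor
  · rintro ⟨p₀, h0, rfl, rfl⟩; exact ⟨h0, rfl⟩
  · rintro ⟨h0, rfl⟩; exact ⟨p, h0, rfl, rfl⟩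

theorem reach_append_singleton {p : Loc} {c : X → ℝ} {w : List (Alph × ℝ)} {a : Alph × ℝ} :
    A.Reach (w ++ [a]) p c ↔ ∃ r ∈ A.rules, ∃ c', A.Reach w r.source c' ∧ r.letter = a.1 ∧
      r.guard.Sat (fun x => a.2 - c' x) ∧ p = r.target ∧ c = upd c' r.resets a.2 := by
  simp only [Reach, path_append]
  constructor
  · rintro ⟨p₀, h0, p', c', h1, r, hr, rfl, h3, h4, h5, h6⟩
    exact ⟨r, hr, c', ⟨p₀, h0, h1⟩, h3, h4, h5, h6⟩
  · rintro ⟨r, hr, c', ⟨p₀, h0, h1⟩, h3, h4, h5, h6⟩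
    exact ⟨p₀, h0, r.source, c', h1, r, hr, rfl, h3, h4, h5, h6⟩

/-- Replaces configurations by bare reset assignments; the monotonicity of the word supplies the
conditions on time that configurations carry. -/
theorem hasAcceptingRun_iff {C : Config X Loc} {v : List (Alph × ℝ)} (hl : ∀ a ∈ v, C.now ≤ a.2)
    (hp : v.Pairwise (fun a b => a.2 ≤ b.2)) :
    A.HasAcceptingRun C v ↔ A.Accepts C.loc C.reset v := by
  induction v generalizing C with
  | nil =>
    constructor
    · intro h; exact ⟨_, _, ⟨rfl, rfl⟩, h⟩
    · rintro ⟨q, d, ⟨rfl, rfl⟩, h⟩; exact h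
  | cons a v ih =>
    rw [List.pairwise_cons] at hp
    constructor
    · rintro ⟨C', ⟨-, hn, r, hr, h1, h2, h3, h4, h5, h6⟩, hC'⟩
      rw [ih (by rw [hn]; exact hp.1) hp.2] at hC'
      obtain ⟨q, d, hq, hf⟩ := hC'
      refine ⟨q, d, ⟨r, hr, h1, h2, h4, ?_⟩, hf⟩
      convert hq using 1
      funext x
      by_cases hx : x ∈ r.resets
      · rw [upd_of_mem hx, h5 x hx]
      · rw [upd_of_notMem hx, h6 x hx]
    · rintro ⟨q, d, ⟨r, hr, h1, h2, h4, hq⟩, hf⟩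
      have ha : C.now ≤ a.2 := hl a (by simp)
      have ha0 := C.now_nonneg.trans ha
      refine ⟨⟨r.target, upd C.reset r.resets a.2, a.2, ha0, fun x => ?_, fun x => ?_⟩,
        ⟨ha, rfl, r, hr, h1, h2, rfl, h4, fun x hx => upd_of_mem hx, fun x hx => upd_of_notMem hx⟩,
        (ih hp.1 hp.2).2 ⟨q, d, hq, hf⟩⟩
      · by_cases hx : x ∈ r.resets
        · rw [upd_of_mem hx]; exact ha0
        · rw [upd_of_notMem hx]; exact C.reset_nonneg x
      · by_cases hx : x ∈ r.resets
        · rw [upd_of_mem hx]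
        · rw [upd_of_notMem hx]; exact (C.reset_le_now x).trans ha

theorem mem_language_iff {w : List (Alph × ℝ)} :
    w ∈ A.language ↔ IsTimedWord w ∧ ∃ p c, A.Reach w p c ∧ p ∈ A.final := by
  constructor
  · rintro ⟨hw, C, ⟨h1, h2, h3⟩, h⟩
    rw [hasAcceptingRun_iff (by rw [h2]; exact hw.1) hw.2] at h
    obtain ⟨q, d, hq, hf⟩ := h
    rw [funext h3] at hq
    exact ⟨hw, q, d, ⟨C.loc, h1, hq⟩, hf⟩
  · rintro ⟨hw, q, d, ⟨p, hp, hq⟩, hf⟩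
    exact ⟨hw, ⟨p, fun _ => 0, 0, le_rfl, fun _ => le_rfl, fun _ => le_rfl⟩,
      ⟨hp, rfl, fun _ => rfl⟩, (hasAcceptingRun_iff hw.1 hw.2).2 ⟨q, d, hq, hf⟩⟩

theorem mem_leftQuotient_language {w v : List (Alph × ℝ)} : v ∈ leftQuotient w A.language ↔
    IsTimedWord (w ++ v) ∧ ∃ p c, A.Reach w p c ∧ A.Accepts p c v := by
  rw [mem_leftQuotient, mem_language_iff]
  constructor
  · rintro ⟨h, -, q, d, ⟨p₀, h0, h1⟩, hf⟩
    obtain ⟨p, c, h2, h3⟩ := path_append.1 h1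
    exact ⟨h, p, c, ⟨p₀, h0, h2⟩, q, d, h3, hf⟩
  · rintro ⟨h, p, c, ⟨p₀, h0, h2⟩, q, d, h3, hf⟩
    exact ⟨h, h, q, d, ⟨p₀, h0, path_append.2 ⟨p, c, h2, h3⟩⟩, hf⟩

theorem Accepts.map {π : ℝ ≃o ℝ} (hπ : IsTimedAutomorphism π) {p : Loc} {c : X → ℝ}
    {v : List (Alph × ℝ)} (h : A.Accepts p c v) :
    A.Accepts p (fun x => π (c x)) (mapWord π v) := by
  obtain ⟨q, d, h, hf⟩ := h
  refine ⟨q, fun x => π (d x), ?_, hf⟩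
  induction v generalizing p c with
  | nil =>
    obtain ⟨rfl, rfl⟩ := h
    exact ⟨rfl, rfl⟩
  | cons a v ih =>
    obtain ⟨r, hr, h1, h2, h3, h4⟩ := h
    refine ⟨r, hr, h1, h2, (hπ.sat_iff a.2 c r.guard).1 h3, ?_⟩
    have := ih h4
    rwa [map_upd] at this

theorem Reach.mem_stamps {w : List (Alph × ℝ)} {p : Loc} {c : X → ℝ} (h : A.Reach w p c) (x : X) :
    c x ∈ stamps w := by
  induction w using List.reverseRecOn generalizing p c with
  | nil =>
    rw [reach_nil] at h
    simp [h.2, Timed.mem_stamps]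
  | append_singleton w a ih =>
    obtain ⟨r, hr, c', hc', -, -, -, rfl⟩ := reach_append_singleton.1 h
    rw [stamps_append_singleton]
    by_cases hx : x ∈ r.resets
    · rw [upd_of_mem hx]; exact Or.inr rfl
    · rw [upd_of_notMem hx]; exact Or.inl (ih hc')

/-- A single clock whose value exceeds the maximal constant can be changed to another such value. -/
theorem Accepts.of_far {A : TimedAutomaton Alph (Fin 1) Loc} {m : ℕ} (hA : A.ConstBoundedBy m)
    {p : Loc} {c c' : Fin 1 → ℝ} {v : List (Alph × ℝ)} (hc : ∀ a ∈ v, c 0 < a.2 - m)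
    (hc' : ∀ a ∈ v, c' 0 < a.2 - m) (h : A.Accepts p c v) : A.Accepts p c' v := by
  obtain ⟨q, d, h, hf⟩ := h
  suffices ∃ d, A.Path p c' v q d by
    obtain ⟨d, hd⟩ := this
    exact ⟨q, d, hd, hf⟩
  induction v generalizing p c c' with
  | nil => exact ⟨_, h.1, rfl⟩
  | cons a v ih =>
    obtain ⟨r, hr, h1, h2, h3, h4⟩ := h
    -- A single clock has only the trivial difference, and its value exceeds every constant on both
    -- sides. Once it is reset the two assignments coincide.
    have hs : SameAtoms m (fun x => a.2 - c x) (fun x => a.2 - c' x) := by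
      have e1 := hc a (by simp)
      have e2 := hc' a (by simp)
      refine ⟨fun x y z _ => by simp [Subsingleton.elim x y], fun x z hz => ?_, fun x z hz => ?_⟩ <;>
      · have hz : (z : ℝ) ≤ m := by exact_mod_cast (abs_le.1 hz).2
        rw [Subsingleton.elim x 0]
        constructor <;> intro <;> linarith
    by_cases hx : (0 : Fin 1) ∈ r.resets
    · have : upd c' r.resets a.2 = upd c r.resets a.2 := by
        funext x
        rw [Subsingleton.elim x 0, upd_of_mem hx, upd_of_mem hx]
      exact ⟨d, r, hr, h1, h2, (hs.sat_iff (hA r hr)).1 h3, by rwa [this]⟩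
    · obtain ⟨d', hd'⟩ := ih (c' := upd c' r.resets a.2)
        (fun b hb => by rw [upd_of_notMem hx]; exact hc b (by simp [hb]))
        (fun b hb => by rw [upd_of_notMem hx]; exact hc' b (by simp [hb])) h4
      exact ⟨d', r, hr, h1, h2, (hs.sat_iff (hA r hr)).1 h3, hd'⟩

end TimedAutomaton
end Timed

namespace Timed
namespace TimedAutomaton

open Filter Topology

variable {Alph X Loc : Type*}

/-! ### Deterministic always resetting automata have small supports -/

theorem Reach.unique {B : TimedAutomaton Alph X Loc} (hB : B.Deterministic)
    {w : List (Alph × ℝ)} (hw : IsTimedWord w) {p p' : Loc} {c c' : X → ℝ} (h : B.Reach w p c)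
    (h' : B.Reach w p' c') : p = p' ∧ c = c' := by
  induction w using List.reverseRecOn generalizing p p' c c' with
  | nil =>
    rw [reach_nil] at h h'
    exact ⟨hB.1.unique h.1 h'.1, h.2.trans h'.2.symm⟩
  | append_singleton w a ih =>
    obtain ⟨r, hr, d, hd, h1, h2, rfl, rfl⟩ := reach_append_singleton.1 h
    obtain ⟨r', hr', d', hd', h1', h2', rfl, rfl⟩ := reach_append_singleton.1 h'
    have hw' := isTimedWord_append_singleton.1 hw
    obtain ⟨e1, rfl⟩ := ih hw'.1 hd hd'
    obtain ⟨e2, e3⟩ := hB.2 r hr r' hr' e1 (h1.trans h1'.symm)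
      ⟨_, fun x => sub_nonneg.2 ((hw'.1.stamps_le (hd.mem_stamps x)).trans hw'.2), h2, h2'⟩
    exact ⟨e3, by rw [e2]⟩

theorem Reach.exists_eq_lastTime [Nonempty X] {B : TimedAutomaton Alph X Loc}
    (hB : B.AlwaysResetting) {w : List (Alph × ℝ)} {p : Loc} {c : X → ℝ} (h : B.Reach w p c) :
    ∃ x, c x = lastTime w := by
  induction w using List.reverseRecOn with
  | nil =>
    rw [reach_nil] at h
    exact ⟨Classical.arbitrary X, by simp [h.2]⟩
  | append_singleton w a ih =>
    obtain ⟨r, hr, d, hd, h1, h2, rfl, rfl⟩ := reach_append_singleton.1 h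
    obtain ⟨x, hx⟩ := hB r hr
    exact ⟨x, by rw [upd_of_mem hx, lastTime_append_singleton]⟩

/-- The support consists of the reset points of the unique configuration reached. If none is
reached, the quotient is empty and the last timestamp suffices. -/
theorem exists_support_of_deterministic {k : ℕ} (hk : 1 ≤ k)
    {B : TimedAutomaton Alph (Fin k) Loc} (hB : B.Deterministic) (hB' : B.AlwaysResetting)
    {w : List (Alph × ℝ)} (hw : IsTimedWord w) :
    ∃ S : Finset ℝ, (∀ s ∈ S, 0 ≤ s) ∧ S.card ≤ k ∧ lastTime w ∈ S ∧
      Supports (S : Set ℝ) (leftQuotient w B.language) := by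
  classical
  have : Nonempty (Fin k) := ⟨⟨0, hk⟩⟩
  by_cases hr : ∃ p c, B.Reach w p c
  · obtain ⟨p, c, hr⟩ := hr
    obtain ⟨x, hx⟩ := hr.exists_eq_lastTime hB'
    have hl : lastTime w ∈ Finset.univ.image c := Finset.mem_image.2 ⟨x, Finset.mem_univ _, hx⟩
    refine ⟨Finset.univ.image c, ?_, Finset.card_image_le.trans (by simp), hl, ?_⟩
    · intro s hs
      obtain ⟨y, -, rfl⟩ := Finset.mem_image.1 hs
      exact hw.stamps_nonneg (hr.mem_stamps y)
    · refine supports_of_forall_mem fun π hπ hf v hv => ?_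
      obtain ⟨h1, p', c', h2, h3⟩ := mem_leftQuotient_language.1 hv
      obtain ⟨rfl, rfl⟩ := Reach.unique hB hw h2 hr
      have h4 := h3.map hπ
      have h5 : (fun x => π (c' x)) = c' := funext fun x => hf _ (by simp)
      rw [h5] at h4
      refine mem_leftQuotient_language.2 ⟨isTimedWord_append.2 ⟨hw, ?_, ?_⟩, p', c', h2, h4⟩
      · intro b hb
        obtain ⟨a, ha, rfl⟩ := List.mem_map.1 hb
        have := π.monotone ((isTimedWord_append.1 h1).2.1 a ha)
        rwa [hf _ hl] at this
      · exact pairwise_mapWord.2 (isTimedWord_append.1 h1).2.2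
  · refine ⟨{lastTime w}, by simpa using hw.lastTime_nonneg, by simpa using hk, by simp, ?_⟩
    refine supports_of_forall_mem fun π hπ hf v hv => ?_
    obtain ⟨-, p, c, h, -⟩ := mem_leftQuotient_language.1 hv
    exact absurd ⟨p, c, h⟩ hr

/-! ### Supports of quotients of one-clock languages -/

theorem mem_leftQuotient_append_singleton {w v : List (Alph × ℝ)} {a : Alph × ℝ}
    {L : Set (List (Alph × ℝ))} : v ∈ leftQuotient (w ++ [a]) L ↔ a :: v ∈ leftQuotient w L := by
  simp [mem_leftQuotient]

/-- The quotient restricted to words that start at time `t₀` or later. -/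
def lateQuotient (w : List (Alph × ℝ)) (L : Set (List (Alph × ℝ))) (t₀ : ℝ) :
    Set (List (Alph × ℝ)) :=
  {v | v ∈ leftQuotient w L ∧ ∀ a ∈ v, t₀ ≤ a.2}

theorem lateQuotient_lastTime (w : List (Alph × ℝ)) (L : Set (List (Alph × ℝ))) :
    lateQuotient w L (lastTime w) = leftQuotient w L := by
  ext v
  refine ⟨fun h => h.1, fun h => ⟨h, (isTimedWord_append.1 (mem_leftQuotient.1 h).1).2.1⟩⟩

theorem forall_le_mapWord {π : ℝ ≃o ℝ} {t₀ : ℝ} (h0 : π t₀ = t₀) {v : List (Alph × ℝ)}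
    (h : ∀ a ∈ v, t₀ ≤ a.2) : ∀ a ∈ mapWord π v, t₀ ≤ a.2 := by
  intro b hb
  obtain ⟨a, ha, rfl⟩ := List.mem_map.1 hb
  have := π.monotone (h a ha)
  rwa [h0] at this

theorem supports_lateQuotient {w : List (Alph × ℝ)} {L : Set (List (Alph × ℝ))} {S : Finset ℝ}
    (hS : Supports (S : Set ℝ) (leftQuotient w L)) (t₀ : ℝ) :
    Supports ((insert t₀ S : Finset ℝ) : Set ℝ) (lateQuotient w L t₀) := by
  refine supports_of_forall_mem fun π hπ hf v hv => ?_
  exact ⟨(hS π hπ (fun s hs => hf s (by simp at hs ⊢; exact Or.inr hs)) v).1 hv.1,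
    forall_le_mapWord (hf t₀ (by simp)) hv.2⟩

theorem supports_leftQuotient_append_singleton {w : List (Alph × ℝ)} {L : Set (List (Alph × ℝ))}
    {S : Finset ℝ} (hS : Supports (S : Set ℝ) (leftQuotient w L)) (a : Alph × ℝ) :
    Supports ((insert a.2 S : Finset ℝ) : Set ℝ) (leftQuotient (w ++ [a]) L) := by
  intro π hπ hf v
  have := hS π hπ (fun s hs => hf s (by simp at hs ⊢; exact Or.inr hs)) (a :: v)
  rw [mapWord_cons, hf a.2 (by simp)] at this
  rwa [mem_leftQuotient_append_singleton, mem_leftQuotient_append_singleton]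

/-- The timestamps of a word that are at most `m` older than `t₀`, and `t₀` itself. -/
noncomputable def recent (w : List (Alph × ℝ)) (m : ℕ) (t₀ : ℝ) : Finset ℝ :=
  insert t₀ ((stamps w).filter (t₀ - m ≤ ·))

theorem mem_recent {w : List (Alph × ℝ)} {m : ℕ} {t₀ u : ℝ} :
    u ∈ recent w m t₀ ↔ u = t₀ ∨ u ∈ stamps w ∧ t₀ - m ≤ u := by
  simp [recent]

/-! ### Recent timestamps as supports for one-clock automata -/

section OneClock

variable {A : TimedAutomaton Alph (Fin 1) Loc} {m k : ℕ}

/-- A reset point that is at least t₀ − m is fixed by `π`. An older one stays older, because `π`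
also fixes t₀ − m, and guards read from t₀ on cannot tell such points apart. -/
theorem supports_recent (hA : A.ConstBoundedBy m) {w : List (Alph × ℝ)} (hw : IsTimedWord w)
    {t₀ : ℝ} (h0 : lastTime w ≤ t₀) :
    Supports (recent w m t₀ : Set ℝ) (lateQuotient w A.language t₀) := by
  refine supports_of_forall_mem fun π hπ hf v hv => ?_
  have hf0 : π t₀ = t₀ := hf t₀ (by simp [mem_recent])
  have hle := forall_le_mapWord hf0 hv.2
  obtain ⟨h1, p, c, h2, h3⟩ := mem_leftQuotient_language.1 hv.1
  refine ⟨mem_leftQuotient_language.2 ⟨isTimedWord_append.2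
    ⟨hw, fun a ha => h0.trans (hle a ha), pairwise_mapWord.2 (isTimedWord_append.1 h1).2.2⟩,
    p, c, h2, ?_⟩, hle⟩
  have h4 := h3.map hπ
  rcases le_or_gt (t₀ - m) (c 0) with hc | hc
  · have : (fun x => π (c x)) = c := funext fun x => hf _ (by
      rw [Subsingleton.elim x 0]
      exact Finset.mem_coe.2 (mem_recent.2 (Or.inr ⟨h2.mem_stamps 0, hc⟩)))
    rwa [this] at h4
  · have hm : π (t₀ - m) = t₀ - m := by
      have := hπ.map_add_int t₀ (-m)
      push_cast at this
      rw [← sub_eq_add_neg, hf0, ← sub_eq_add_neg] at this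
      exact this
    have hc' := π.strictMono hc
    rw [hm] at hc'
    exact h4.of_far hA (fun a ha => by linarith [hle a ha]) (fun a ha => by linarith [hle a ha])

theorem supports_leftQuotient_recent (hA : A.ConstBoundedBy m) {w : List (Alph × ℝ)}
    (hw : IsTimedWord w) :
    Supports (recent w m (lastTime w) : Set ℝ) (leftQuotient w A.language) := by
  have := supports_recent hA hw le_rfl
  rwa [lateQuotient_lastTime] at this

/-! ### Tracking the least support with clocks -/

/-- The least support of the quotient by `w`. -/
def wordCore (A : TimedAutomaton Alph X Loc) (w : List (Alph × ℝ)) : Set ℝ :=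
  core (leftQuotient w A.language) (lastTime w)

/-- The clocks to be reset on reading `a` after `w`. -/
def resetSet (A : TimedAutomaton Alph X Loc) (w : List (Alph × ℝ)) (c : Fin k → ℝ)
    (a : Alph × ℝ) : Set (Fin k) :=
  {x | c x ∉ A.wordCore (w ++ [a]) ∨ ZEq (c x) a.2 ∨ ∃ y < x, c y = c x}

/-- Assignments of reset points to clocks, obtained from always resetting the clocks that do not
hold a needed point. -/
inductive Track (A : TimedAutomaton Alph X Loc) : List (Alph × ℝ) → (Fin k → ℝ) → Prop
  | nil : Track A [] fun _ => 0
  | snoc {w : List (Alph × ℝ)} {c : Fin k → ℝ} {a : Alph × ℝ} : Track A w c →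
      IsTimedWord (w ++ [a]) → Track A (w ++ [a]) (upd c (resetSet A w c a) a.2)

/-- The clocks hold the least support, each class being represented by its latest timestamp. -/
structure Tracks (A : TimedAutomaton Alph X Loc) (w : List (Alph × ℝ)) (c : Fin k → ℝ) :
    Prop where
  timed : IsTimedWord w
  mem_stamps : ∀ x, c x ∈ stamps w
  mem_core : ∀ x, c x ∈ A.wordCore w
  cover : ∀ a ∈ A.wordCore w, ∃ x, ZEq a (c x)
  eq_of_zeq : ∀ x y, ZEq (c x) (c y) → c x = c y
  last : ∃ x, c x = lastTime w
  max : ∀ u ∈ stamps w, ∀ x, ZEq u (c x) → u ≤ c x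

/-- All quotients have supports of size at most `k`. -/
def SmallSupports (A : TimedAutomaton Alph X Loc) (k : ℕ) : Prop :=
  ∀ w : List (Alph × ℝ), IsTimedWord w → ∃ S : Finset ℝ, S.card ≤ k ∧ lastTime w ∈ S ∧
    Supports (S : Set ℝ) (leftQuotient w A.language)

theorem Tracks.le {w : List (Alph × ℝ)} {c : Fin k → ℝ} (h : Tracks A w c) (x : Fin k) :
    c x ≤ lastTime w := h.timed.stamps_le (h.mem_stamps x)

theorem Tracks.supports (hA : A.ConstBoundedBy m) {w : List (Alph × ℝ)} {c : Fin k → ℝ}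
    (h : Tracks A w c) :
    Supports ((Finset.univ.image c : Finset ℝ) : Set ℝ) (leftQuotient w A.language) :=
  supports_of_core_subset (supports_leftQuotient_recent hA h.timed) (mem_recent.2 (Or.inl rfl))
    fun a ha => by
      obtain ⟨x, hx⟩ := h.cover a ha
      exact ⟨c x, by simp, hx⟩

/-- The recent timestamps form a support, so the class of `c x` contains one of them, and `c x` is
the latest timestamp of its class. -/
theorem Tracks.ge (hA : A.ConstBoundedBy m) {w : List (Alph × ℝ)} {c : Fin k → ℝ}
    (h : Tracks A w c) (x : Fin k) : lastTime w - m ≤ c x := by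
  have hm : (0 : ℝ) ≤ m := m.cast_nonneg
  obtain ⟨u, hu, hxu⟩ := h.mem_core x (recent w m (lastTime w)) (mem_recent.2 (Or.inl rfl))
    (supports_leftQuotient_recent hA h.timed)
  rcases mem_recent.1 hu with rfl | ⟨hu, hu'⟩
  · linarith [h.max _ (lastTime_mem_stamps w) x hxu.symm]
  · exact hu'.trans (h.max u hu x hxu.symm)

theorem Tracks.mem_core_append_singleton (hA : A.ConstBoundedBy m) {w : List (Alph × ℝ)}
    {c : Fin k → ℝ} (h : Tracks A w c) {a : Alph × ℝ} {b : ℝ} (hb : b ∈ A.wordCore (w ++ [a])) :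
    ZEq b a.2 ∨ ∃ x, ZEq b (c x) := by
  obtain ⟨s, hs, hbs⟩ := hb (insert a.2 (Finset.univ.image c)) (by simp)
    (supports_leftQuotient_append_singleton (h.supports hA) a)
  rcases Finset.mem_insert.1 hs with rfl | hs
  · exact Or.inl hbs
  · obtain ⟨x, -, rfl⟩ := Finset.mem_image.1 hs
    exact Or.inr ⟨x, hbs⟩

/-- Without a reset, the clocks would hold k pairwise incongruent points of the new core, none
congruent to the new time. A support containing the new time would then need k + 1 points. -/
theorem Tracks.resetSet_nonempty (hS : A.SmallSupports k) {w : List (Alph × ℝ)} {c : Fin k → ℝ}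
    (h : Tracks A w c) {a : Alph × ℝ} (ha : IsTimedWord (w ++ [a])) :
    (resetSet A w c a).Nonempty := by
  by_contra hne
  rw [Set.not_nonempty_iff_eq_empty] at hne
  have hx : ∀ x, c x ∈ A.wordCore (w ++ [a]) ∧ ¬ ZEq (c x) a.2 ∧ ∀ y < x, c y ≠ c x := by
    intro x
    have : x ∉ resetSet A w c a := by rw [hne]; simp
    simp only [resetSet, Set.mem_ofPred_eq, not_or, not_not, not_exists, not_and] at this
    exact this
  have hinj : Function.Injective c := by
    intro x y hxy
    rcases lt_trichotomy x y with hlt | rfl | hlt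
    · exact absurd hxy ((hx y).2.2 x hlt)
    · rfl
    · exact absurd hxy.symm ((hx x).2.2 y hlt)
  obtain ⟨S, hcard, hl, hsup⟩ := hS _ ha
  choose f hfS hf using fun x => (hx x).1 S hl hsup
  rw [lastTime_append_singleton] at hl
  have hfinj : Function.Injective f := by
    intro x y hxy
    apply hinj
    apply h.eq_of_zeq
    exact (hf x).trans (hxy ▸ (hf y).symm)
  have h1 : Finset.univ.image f ⊆ S.erase a.2 := by
    intro s hs
    obtain ⟨x, -, rfl⟩ := Finset.mem_image.1 hs
    exact Finset.mem_erase.2 ⟨fun e => (hx x).2.1 (e ▸ hf x), hfS x⟩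
  have h2 := Finset.card_le_card h1
  rw [Finset.card_image_of_injective _ hfinj, Finset.card_erase_of_mem hl, Finset.card_univ,
    Fintype.card_fin] at h2
  have := Finset.card_pos.2 ⟨_, hl⟩
  omega

theorem Tracks.snoc (hA : A.ConstBoundedBy m) (hS : A.SmallSupports k) {w : List (Alph × ℝ)}
    {c : Fin k → ℝ} (h : Tracks A w c) {a : Alph × ℝ} (ha : IsTimedWord (w ++ [a])) :
    Tracks A (w ++ [a]) (upd c (resetSet A w c a) a.2) := by
  obtain ⟨x₀, hx₀⟩ := h.resetSet_nonempty hS ha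
  have hnot : ∀ x, x ∉ resetSet A w c a →
      c x ∈ A.wordCore (w ++ [a]) ∧ ¬ ZEq (c x) a.2 ∧ ∀ y < x, c y ≠ c x := by
    intro x hx
    simpa only [resetSet, Set.mem_ofPred_eq, not_or, not_not, not_exists, not_and] using hx
  refine ⟨ha, fun x => ?_, fun x => ?_, fun b hb => ?_, fun x y => ?_, ⟨x₀, ?_⟩, fun u hu x => ?_⟩
  · rw [stamps_append_singleton]
    by_cases hx : x ∈ resetSet A w c a
    · rw [upd_of_mem hx]; exact Or.inr rfl
    · rw [upd_of_notMem hx]; exact Or.inl (h.mem_stamps x)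
  · by_cases hx : x ∈ resetSet A w c a
    · rw [upd_of_mem hx, wordCore, lastTime_append_singleton]; exact self_mem_core _
    · rw [upd_of_notMem hx]; exact (hnot x hx).1
  · by_cases hba : ZEq b a.2
    · exact ⟨x₀, by rwa [upd_of_mem hx₀]⟩
    obtain ⟨x, hx⟩ := (h.mem_core_append_singleton hA hb).resolve_left hba
    -- Among clocks with equal content, the one of least index is not reset as a duplicate.
    obtain ⟨y, hy, hmin⟩ := Finset.exists_min_image (Finset.univ.filter fun y => c y = c x) id
      ⟨x, by simp⟩
    simp only [Finset.mem_filter, Finset.mem_univ, true_and, id] at hy hmin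
    refine ⟨y, ?_⟩
    rw [upd_of_notMem, hy]
    · exact hx
    · rintro (h1 | h1 | ⟨z, hz, h1⟩)
      · exact h1 (mem_core_of_zeq (hy ▸ hx.symm) hb)
      · exact hba ((hy ▸ hx).trans h1)
      · exact absurd (hmin z (h1.trans hy)) (not_le.2 hz)
  · by_cases hx : x ∈ resetSet A w c a <;> by_cases hy : y ∈ resetSet A w c a
    · rw [upd_of_mem hx, upd_of_mem hy]; exact fun _ => rfl
    · rw [upd_of_mem hx, upd_of_notMem hy]; exact fun e => absurd e.symm (hnot y hy).2.1
    · rw [upd_of_notMem hx, upd_of_mem hy]; exact fun e => absurd e (hnot x hx).2.1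
    · rw [upd_of_notMem hx, upd_of_notMem hy]; exact h.eq_of_zeq x y
  · rw [upd_of_mem hx₀, lastTime_append_singleton]
  · by_cases hx : x ∈ resetSet A w c a
    · rw [upd_of_mem hx]
      intro _
      have := ha.stamps_le hu
      rwa [lastTime_append_singleton] at this
    · rw [upd_of_notMem hx]
      rcases (stamps_append_singleton w a u).1 hu with hu | rfl
      · exact h.max u hu x
      · exact fun e => absurd e.symm (hnot x hx).2.1

theorem Track.tracks (hk : 1 ≤ k) (hA : A.ConstBoundedBy m) (hS : A.SmallSupports k)
    {w : List (Alph × ℝ)} {c : Fin k → ℝ} (h : Track A w c) : Tracks A w c := by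
  induction h with
  | nil =>
    refine ⟨IsTimedWord.nil, fun _ => by simp [Timed.mem_stamps], fun _ => self_mem_core _,
      fun b hb => ?_, fun _ _ _ => rfl, ⟨⟨0, hk⟩, rfl⟩, fun u hu x _ => ?_⟩
    · obtain ⟨s, hs, hbs⟩ := hb _ (mem_recent.2 (Or.inl rfl))
        (supports_leftQuotient_recent hA IsTimedWord.nil)
      refine ⟨⟨0, hk⟩, ?_⟩
      have : s = 0 := by
        rcases mem_recent.1 hs with h | ⟨h, -⟩
        exacts [h, by simpa [Timed.mem_stamps] using h]
      rwa [← this]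
    · simp [Timed.mem_stamps] at hu; exact hu.le
  | snoc _ ha ih => exact ih.snoc hA hS ha

end OneClock
end TimedAutomaton
end Timed

namespace Timed
namespace TimedAutomaton

open Filter Topology

variable {Alph Loc : Type*} {A : TimedAutomaton Alph (Fin 1) Loc} {m k : ℕ}

/-! ### Similarity of words, and its congruence property -/

/-- A timed automorphism relates the quotients and the reset points. -/
def Similar (A : TimedAutomaton Alph (Fin 1) Loc) (w : List (Alph × ℝ)) (c : Fin k → ℝ)
    (w' : List (Alph × ℝ)) (c' : Fin k → ℝ) : Prop :=
  ∃ π : ℝ ≃o ℝ, IsTimedAutomorphism π ∧ (∀ x, π (c x) = c' x) ∧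
    ∀ v, v ∈ leftQuotient w A.language ↔ mapWord π v ∈ leftQuotient w' A.language

variable {w w' w'' : List (Alph × ℝ)} {c c' c'' : Fin k → ℝ}

theorem Similar.refl (w : List (Alph × ℝ)) (c : Fin k → ℝ) : Similar A w c w c :=
  ⟨OrderIso.refl ℝ, IsTimedAutomorphism.refl, fun _ => rfl, fun v => by simp [mapWord]⟩

theorem Similar.symm (h : Similar A w c w' c') : Similar A w' c' w c := by
  obtain ⟨π, hπ, hc, hL⟩ := h
  exact ⟨π.symm, hπ.symm, fun x => by rw [OrderIso.symm_apply_eq, hc x],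
    fun v => by rw [hL, mapWord_mapWord_symm]⟩

theorem Similar.trans (h : Similar A w c w' c') (h' : Similar A w' c' w'' c'') :
    Similar A w c w'' c'' := by
  obtain ⟨π, hπ, hc, hL⟩ := h
  obtain ⟨ρ, hρ, hc', hL'⟩ := h'
  exact ⟨π.trans ρ, hπ.trans hρ, fun x => by simp [hc, hc'],
    fun v => by rw [hL, hL', mapWord_trans]⟩

theorem Similar.mem_language_iff (h : Similar A w c w' c') (hw : IsTimedWord w)
    (hw' : IsTimedWord w') : w ∈ A.language ↔ w' ∈ A.language := by
  obtain ⟨π, hπ, hc, hL⟩ := h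
  have := hL []
  simpa [mem_leftQuotient, mapWord, hw, hw'] using this

theorem map_lastTime (h : Tracks A w c) (h' : Tracks A w' c') {π : ℝ ≃o ℝ}
    (hc : ∀ x, π (c x) = c' x) : π (lastTime w) = lastTime w' := by
  obtain ⟨x, hx⟩ := h.last
  obtain ⟨y, hy⟩ := h'.last
  apply le_antisymm
  · rw [← hx, hc]; exact h'.le x
  · rw [← hy, ← hc]; exact π.monotone (h.le y)

/-- At both reading times every reset point of `A` is more than m old, so the transported run may
start from the original reset point. -/
theorem mem_leftQuotient_of_far (hA : A.ConstBoundedBy m) {σ : Alph} {t t' : ℝ}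
    (ht : lastTime w < t - m) (ht' : lastTime w < t' - m) {π : ℝ ≃o ℝ}
    (hπ : IsTimedAutomorphism π) (hπt : π t = t') {v : List (Alph × ℝ)}
    (hv : v ∈ leftQuotient (w ++ [(σ, t)]) A.language) :
    mapWord π v ∈ leftQuotient (w ++ [(σ, t')]) A.language := by
  rw [mem_leftQuotient_append_singleton] at hv ⊢
  obtain ⟨h1, p, c, h2, h3⟩ := mem_leftQuotient_language.1 hv
  obtain ⟨hw, h4, h5⟩ := isTimedWord_append.1 h1
  have h6 := h3.map hπ
  have h7 := pairwise_mapWord (π := π).2 h5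
  have e : mapWord π ((σ, t) :: v) = (σ, t') :: mapWord π v := by rw [mapWord_cons]; simp [hπt]
  rw [e] at h6 h7
  have hle : ∀ a ∈ (σ, t') :: mapWord π v, t' ≤ a.2 := by
    intro a ha
    rcases List.mem_cons.1 ha with rfl | ha
    · exact le_rfl
    · exact (List.pairwise_cons.1 h7).1 a ha
  have hc := hw.stamps_le (h2.mem_stamps 0)
  have hm : (0 : ℝ) ≤ m := m.cast_nonneg
  refine mem_leftQuotient_language.2 ⟨isTimedWord_append.2 ⟨hw, fun a ha => ?_, h7⟩, p, c, h2,
    h6.of_far hA (fun a ha => ?_) (fun a ha => ?_)⟩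
  · linarith [hle a ha]
  · have e2 : π (t - m) = t' - m := by
      have := hπ.map_add_int t (-m)
      push_cast at this
      rw [← sub_eq_add_neg, hπt, ← sub_eq_add_neg] at this
      exact this
    have := π.strictMono (hc.trans_lt ht)
    rw [e2] at this
    linarith [hle a ha]
  · linarith [hle a ha]

/-- If every clock is more than m old at t, any automorphism moving t to t' works. Otherwise the
quotient is restricted to words starting at some t₀ just before t. This makes the old clocks
irrelevant, and an automorphism can move t to t' while fixing t₀ and the recent clocks. -/
theorem exists_transport_of_lt (hA : A.ConstBoundedBy m) (h : Tracks A w c) {σ : Alph} {t t' : ℝ}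
    (ht : lastTime w ≤ t) (htt : t < t')
    (hs : SameAtoms m (fun x => t - c x) (fun x => t' - c x)) :
    ∃ π : ℝ ≃o ℝ, IsTimedAutomorphism π ∧ π t = t' ∧ (∀ x, t - c x ≤ m → π (c x) = c x) ∧
      ∀ v, v ∈ leftQuotient (w ++ [(σ, t)]) A.language ↔
        mapWord π v ∈ leftQuotient (w ++ [(σ, t')]) A.language := by
  classical
  have hm : (0 : ℝ) ≤ m := m.cast_nonneg
  have habs : |(m : ℤ)| ≤ m := by simp
  by_cases hP : ∃ x, t - c x ≤ m
  swap
  · push Not at hP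
    obtain ⟨π, hπ, hπt⟩ := exists_translation t t'
    obtain ⟨x, hx⟩ := h.last
    have h1 : lastTime w < t - m := by linarith [hP x]
    refine ⟨π, hπ, hπt, fun x hx => absurd hx (not_le.2 (hP x)), fun v =>
      ⟨mem_leftQuotient_of_far hA h1 (by linarith) hπ hπt, fun hv => ?_⟩⟩
    rw [← mapWord_symm_mapWord π v]
    exact mem_leftQuotient_of_far hA (by linarith) h1 hπ.symm
      (by rw [OrderIso.symm_apply_eq, hπt]) hv
  obtain ⟨x₀, hx₀⟩ := hP
  -- Such a z lies between 0 and m, so the equivalence of t and t' would force t' ≤ c x + z ≤ t.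
  have hgap : ∀ x, t - c x ≤ m → ∀ z : ℤ, t ≤ c x + z → ¬ c x + z ≤ t' := by
    intro x hx z h1 h2
    have h3 : t' - c x ≤ m := (hs.le x m habs).1 (by exact_mod_cast hx)
    have z1 : (z : ℝ) ≤ (m : ℤ) := by push_cast; linarith
    have z0 : (0 : ℝ) ≤ z := by linarith [h.le x]
    have z1 : z ≤ m := by exact_mod_cast z1
    have z0 : 0 ≤ z := by exact_mod_cast z0
    have hz : |z| ≤ m := abs_le.2 ⟨by omega, z1⟩
    have := (hs.le x z hz).1 (by linarith)
    have := (hs.ge x z hz).2 (by linarith)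
    linarith
  -- At t = `lastTime w` the clock reset last has value 0, which the constant 0 distinguishes from
  -- its value at t'.
  have hlt : lastTime w < t := by
    refine lt_of_le_of_ne ht ?_
    intro e
    obtain ⟨y, hy⟩ := h.last
    have := hgap y (by rw [hy, e]; simp) 0
    push_cast at this
    rw [hy, e] at this
    exact this (by simp) (by simpa using htt.le)
  let P : Finset ℝ := (Finset.univ.filter fun x => t - c x ≤ m).image c
  have hP : ∀ p, p ∈ P ↔ ∃ x, t - c x ≤ m ∧ c x = p := by simp [P]
  obtain ⟨s, hst, hs'⟩ := exists_lt_avoiding P (s := t) (by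
    intro p hp
    obtain ⟨x, hx, rfl⟩ := (hP p).1 hp
    rintro ⟨z, hz⟩
    exact hgap x hx z hz.le (by linarith))
  obtain ⟨t₀, ⟨⟨h1, h2⟩, h3⟩, h4⟩ : ∃ t₀, ((s < t₀ ∧ lastTime w < t₀) ∧
      (∀ x, m < t - c x → m < t₀ - c x)) ∧ t₀ < t := by
    have e1 : ∀ᶠ t₀ in 𝓝[<] t, s < t₀ := (eventually_gt_nhds hst).filter_mono nhdsWithin_le_nhds
    have e2 : ∀ᶠ t₀ in 𝓝[<] t, lastTime w < t₀ :=
      (eventually_gt_nhds hlt).filter_mono nhdsWithin_le_nhds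
    have e3 : ∀ᶠ t₀ in 𝓝[<] t, ∀ x, m < t - c x → m < t₀ - c x := by
      rw [eventually_all]
      intro x
      by_cases hx : m < t - c x
      · filter_upwards [(eventually_gt_nhds (show c x + m < t by linarith)).filter_mono
          nhdsWithin_le_nhds] with u hu _
        linarith
      · exact Eventually.of_forall fun u hu => absurd hu hx
    have e4 : ∀ᶠ t₀ in 𝓝[<] t, t₀ < t := eventually_mem_nhdsWithin
    exact (((e1.and e2).and e3).and e4).exists
  -- Intersect the support by all clocks with the support by recent timestamps. A clock congruent to
  -- a recent timestamp is itself recent, and by the choice of t₀ it is then at most m old at t.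
  have hsup : Supports ((insert t₀ P : Finset ℝ) : Set ℝ) (lateQuotient w A.language t₀) := by
    refine ((supports_lateQuotient (h.supports hA) t₀).inter (supports_recent hA h.timed h2.le)
      (t₀ := t₀) (by simp) (mem_recent.2 (Or.inl rfl))).mono ?_
    rintro p ⟨hp, u, hu, hpu⟩
    rcases Finset.mem_insert.1 hp with rfl | hp
    · exact ⟨p, by simp, ZEq.refl p⟩
    obtain ⟨x, -, rfl⟩ := Finset.mem_image.1 hp
    rcases mem_recent.1 hu with rfl | ⟨hu, hu'⟩
    · exact ⟨u, by simp, hpu⟩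
    · have := h.max u hu x hpu.symm
      refine ⟨c x, ?_, ZEq.refl _⟩
      rw [Finset.coe_insert]
      refine Or.inr (Finset.mem_coe.2 ((hP _).2 ⟨x, ?_, rfl⟩))
      by_contra hc
      linarith [h3 x (not_le.1 hc)]
  obtain ⟨π, hπ, hπf, hπt⟩ := exists_move_of_le (P := insert t₀ P) ⟨t₀, by simp⟩ htt.le (by
    intro p hp z hz1 hz2
    rcases Finset.mem_insert.1 hp with rfl | hp
    · have z0 : (0 : ℝ) < z := by linarith
      have z0 : 0 < z := by exact_mod_cast z0
      have z1 : (1 : ℝ) ≤ z := by exact_mod_cast z0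
      -- The first translate of `c x₀` after t₀ is at most t₀ + 1. It is neither in [t₀, t] nor in
      -- [t, t'], so t' < t₀ + 1.
      have f1 := Int.floor_le (p - c x₀)
      have f2 := Int.lt_floor_add_one (p - c x₀)
      have g1 := hs' (c x₀) ((hP _).2 ⟨x₀, hx₀, rfl⟩) (⌊p - c x₀⌋ + 1)
      have g2 := hgap x₀ hx₀ (⌊p - c x₀⌋ + 1)
      push_cast at g1 g2
      have g3 := not_le.1 (g1 (by linarith))
      exact g2 g3.le (by linarith)
    · obtain ⟨x, hx, rfl⟩ := (hP p).1 hp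
      exact hgap x hx z hz1 hz2)
  refine ⟨π, hπ, hπt, fun x hx => hπf _ (Finset.mem_insert_of_mem ((hP _).2 ⟨x, hx, rfl⟩)), ?_⟩
  intro v
  have hlate : ∀ (u : ℝ) (v : List (Alph × ℝ)), t ≤ u →
      ((σ, u) :: v ∈ leftQuotient w A.language ↔ (σ, u) :: v ∈ lateQuotient w A.language t₀) := by
    intro u v hu
    refine ⟨fun hv => ⟨hv, fun a ha => ?_⟩, fun hv => hv.1⟩
    have := (isTimedWord_append.1 (mem_leftQuotient.1 hv).1).2.2
    rcases List.mem_cons.1 ha with rfl | ha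
    · exact (h4.le).trans hu
    · exact (h4.le.trans hu).trans ((List.pairwise_cons.1 this).1 a ha)
  rw [mem_leftQuotient_append_singleton, mem_leftQuotient_append_singleton, hlate t v le_rfl,
    hlate t' _ htt.le, hsup π hπ (fun p hp => hπf p (Finset.mem_coe.1 hp)) ((σ, t) :: v),
    mapWord_cons]
  simp [hπt]

theorem exists_transport (hA : A.ConstBoundedBy m) (h : Tracks A w c) {σ : Alph} {t t' : ℝ}
    (ht : lastTime w ≤ t) (ht' : lastTime w ≤ t')
    (hs : SameAtoms m (fun x => t - c x) (fun x => t' - c x)) :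
    ∃ π : ℝ ≃o ℝ, IsTimedAutomorphism π ∧ π t = t' ∧ (∀ x, t - c x ≤ m → π (c x) = c x) ∧
      ∀ v, v ∈ leftQuotient (w ++ [(σ, t)]) A.language ↔
        mapWord π v ∈ leftQuotient (w ++ [(σ, t')]) A.language := by
  rcases lt_trichotomy t t' with hlt | rfl | hlt
  · exact exists_transport_of_lt hA h ht hlt hs
  · exact ⟨OrderIso.refl ℝ, IsTimedAutomorphism.refl, rfl, fun _ _ => rfl, by simp [mapWord]⟩
  · obtain ⟨π, hπ, hπt, hπc, hL⟩ := exists_transport_of_lt (σ := σ) hA h ht' hlt hs.symm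
    refine ⟨π.symm, hπ.symm, by rw [OrderIso.symm_apply_eq, hπt], fun x hx => ?_, fun v => ?_⟩
    · rw [OrderIso.symm_apply_eq, hπc x]
      have := (hs.le x m (by simp)).1 (by exact_mod_cast hx)
      exact_mod_cast this
    · rw [hL, mapWord_mapWord_symm]

/-- A clock that is kept holds a core point not congruent to the new time, so its class contains a
recent timestamp of `w`. Being the latest of the class, the clock is at most m old. -/
theorem mem_resetSet_of_far (hA : A.ConstBoundedBy m) (h : Tracks A w c) {a : Alph × ℝ}
    (ha : IsTimedWord (w ++ [a])) {x : Fin k} (hx : m < a.2 - c x) : x ∈ resetSet A w c a := by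
  by_contra hn
  simp only [resetSet, Set.mem_ofPred_eq, not_or, not_not] at hn
  obtain ⟨u, hu, hxu⟩ := hn.1 (recent (w ++ [a]) m (lastTime (w ++ [a])))
    (mem_recent.2 (Or.inl rfl)) (supports_leftQuotient_recent hA ha)
  rw [mem_recent, lastTime_append_singleton, stamps_append_singleton] at hu
  rcases hu with rfl | ⟨hu | rfl, hu'⟩
  · exact hn.2.1 hxu
  · linarith [h.max u hu x hxu.symm]
  · exact hn.2.1 hxu

/-- Reading a letter at region equivalent times preserves similarity and resets the same clocks. -/
theorem Similar.congr (hA : A.ConstBoundedBy m) (hT : Tracks A w c) (hT' : Tracks A w' c')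
    (h : Similar A w c w' c') {σ : Alph} {t t' : ℝ} (ht : lastTime w ≤ t) (ht' : lastTime w' ≤ t')
    (hs : SameAtoms m (fun x => t - c x) (fun x => t' - c' x)) :
    resetSet A w c (σ, t) = resetSet A w' c' (σ, t') ∧
      Similar A (w ++ [(σ, t)]) (upd c (resetSet A w c (σ, t)) t)
        (w' ++ [(σ, t')]) (upd c' (resetSet A w' c' (σ, t')) t') := by
  obtain ⟨π, hπ, hc, hL⟩ := h
  have hl := map_lastTime hT hT' hc
  -- Pulling t' back along `π` reduces the claim to two reading times after the same word.
  have ht1 : lastTime w ≤ π.symm t' := by rw [OrderIso.le_symm_apply, hl]; exact ht'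
  have hs1 : SameAtoms m (fun x => t - c x) (fun x => π.symm t' - c x) := by
    have := hπ.sameAtoms m (π.symm t') c
    simp only [OrderIso.apply_symm_apply, hc] at this
    exact hs.trans this.symm
  obtain ⟨ρ, hρ, hρt, hρc, hρL⟩ := exists_transport (σ := σ) hA hT ht ht1 hs1
  have hκ := hρ.trans hπ
  set κ := ρ.trans π with hκdef
  have hκt : κ t = t' := by simp [hκdef, hρt]
  have hκc : ∀ x, t - c x ≤ m → κ (c x) = c' x := fun x hx => by simp [hκdef, hρc x hx, hc]
  have hκL : ∀ v, v ∈ leftQuotient (w ++ [(σ, t)]) A.language ↔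
      mapWord κ v ∈ leftQuotient (w' ++ [(σ, t')]) A.language := by
    intro v
    rw [hρL, mem_leftQuotient_append_singleton, hL, mem_leftQuotient_append_singleton,
      mapWord_cons, mapWord_trans]
    simp
  have hw1 : IsTimedWord (w ++ [(σ, t)]) := isTimedWord_append_singleton.2 ⟨hT.timed, ht⟩
  have hw1' : IsTimedWord (w' ++ [(σ, t')]) := isTimedWord_append_singleton.2 ⟨hT'.timed, ht'⟩
  have hY : resetSet A w c (σ, t) = resetSet A w' c' (σ, t') := by
    ext x
    -- `κ` is only known to match clocks that are at most m old; all others are reset on both sides.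
    by_cases hx : t - c x ≤ m
    · have h1 : c x ∈ A.wordCore (w ++ [(σ, t)]) ↔ c' x ∈ A.wordCore (w' ++ [(σ, t')]) := by
        have := mem_core_image_iff hκ hκL (t₀ := t) (a := c x)
        rw [hκt, hκc x hx] at this
        simp only [wordCore, lastTime_append_singleton]
        exact this.symm
      have h2 : ZEq (c x) t ↔ ZEq (c' x) t' := by
        rw [← hκ.zeq_iff, hκt, hκc x hx]
      have h3 : ∀ y, c y = c x ↔ c' y = c' x := fun y => by
        rw [← hc, ← hc, π.injective.eq_iff]
      simp only [resetSet, Set.mem_ofPred_eq, h1, h2, h3]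
    · have hx' : ¬ t' - c' x ≤ m := by
        have := hs.le x m (by simp)
        intro h
        exact hx (by exact_mod_cast this.2 (by exact_mod_cast h))
      exact iff_of_true (mem_resetSet_of_far hA hT hw1 (not_le.1 hx))
        (mem_resetSet_of_far hA hT' hw1' (not_le.1 hx'))
  refine ⟨hY, κ, hκ, fun x => ?_, hκL⟩
  by_cases hx : x ∈ resetSet A w c (σ, t)
  · rw [upd_of_mem hx, upd_of_mem (hY ▸ hx), hκt]
  · rw [upd_of_notMem hx, upd_of_notMem (hY ▸ hx)]
    apply hκc
    by_contra hc
    exact hx (mem_resetSet_of_far hA hT hw1 (not_le.1 hc))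

end TimedAutomaton
end Timed

namespace Timed
namespace TimedAutomaton

variable {Alph Loc : Type*} {A : TimedAutomaton Alph (Fin 1) Loc} {m k : ℕ}
variable {w w' : List (Alph × ℝ)} {c c' : Fin k → ℝ}

/-! ### Generic representatives -/

/-- In a sparse state, some class of timestamps relative to the clocks is not occupied or the number
of classes is not maximal: either no timestamp is exactly `m` old, or two clocks coincide, or no
timestamp lies between the current time and the translates of the clocks before it. -/
def IsSparse (m : ℕ) (w : List (Alph × ℝ)) (c : Fin k → ℝ) : Prop :=
  lastTime w - m ∉ stamps w ∨ ¬ Function.Injective c ∨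
    ∀ u ∈ stamps w, u < lastTime w → ∃ x, ∃ z : ℤ, u ≤ c x + z ∧ c x + z < lastTime w

theorem IsSparse.snoc_of_notMem (hm : 1 ≤ m) {a : Alph × ℝ} (ha : a.2 - m ∉ stamps w) :
    IsSparse m (w ++ [a]) c := by
  have : (1 : ℝ) ≤ m := by exact_mod_cast hm
  refine Or.inl ?_
  rw [lastTime_append_singleton, stamps_append_singleton]
  rintro (h | h)
  · exact ha h
  · linarith

/-- The reading time is already held by a clock, so the new reset points are among the old ones. If
the new clocks are distinct, counting shows that the two sets agree. -/
theorem IsSparse.snoc_of_eq (hT : Tracks A w c) (h : IsSparse m w c) {a : Alph × ℝ}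
    (ha : a.2 = lastTime w) (Y : Set (Fin k)) : IsSparse m (w ++ [a]) (upd c Y a.2) := by
  classical
  have hst : ∀ u, u ∈ stamps (w ++ [a]) ↔ u ∈ stamps w := fun u => by
    rw [stamps_append_singleton]
    refine ⟨?_, Or.inl⟩
    rintro (h | rfl)
    exacts [h, ha ▸ lastTime_mem_stamps w]
  by_cases hinj : Function.Injective (upd c Y a.2)
  swap
  · exact Or.inr (Or.inl hinj)
  have hsub : Finset.univ.image (upd c Y a.2) ⊆ Finset.univ.image c := by
    intro s hs
    obtain ⟨x, -, rfl⟩ := Finset.mem_image.1 hs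
    by_cases hx : x ∈ Y
    · obtain ⟨y, hy⟩ := hT.last
      rw [upd_of_mem hx, ha, ← hy]; simp
    · rw [upd_of_notMem hx]; simp
  have hcard : (Finset.univ.image (upd c Y a.2)).card = k := by
    rw [Finset.card_image_of_injective _ hinj]; simp
  have hle : (Finset.univ.image c).card ≤ k := Finset.card_image_le.trans (by simp)
  have heq := Finset.eq_of_subset_of_card_le hsub (by omega)
  rcases h with h | h | h
  · left
    rwa [lastTime_append_singleton, hst, ha]
  · refine absurd ?_ h
    have : Set.InjOn c (Finset.univ : Finset (Fin k)) :=
      Finset.card_image_iff.1 (by rw [← heq, hcard]; simp)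
    simpa [Set.injOn_univ] using this
  · right; right
    intro u hu hlt
    rw [lastTime_append_singleton, ha] at hlt ⊢
    obtain ⟨x, z, h1, h2⟩ := h u ((hst u).1 hu) hlt
    have hx : c x ∈ Finset.univ.image (upd c Y a.2) := by rw [heq]; simp
    obtain ⟨y, -, hy⟩ := Finset.mem_image.1 hx
    refine ⟨y, z, ?_⟩
    rw [← ha, hy, ha]
    exact ⟨h1, h2⟩

/-- Clock `x` is reset. If the clock holding the previous last time survives, it separates earlier
timestamps from the new time; if it is `x`, the new time minus 1 does. Otherwise two clocks
coincide. -/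
theorem isSparse_snoc_of_zeq (hT : Tracks A w c) {a : Alph × ℝ} (ha : lastTime w < a.2)
    {x : Fin k} (hx : ZEq a.2 (c x)) :
    IsSparse m (w ++ [a]) (upd c (resetSet A w c a) a.2) := by
  by_cases hinj : Function.Injective (upd c (resetSet A w c a) a.2)
  swap
  · exact Or.inr (Or.inl hinj)
  have hxY : x ∈ resetSet A w c a := Or.inr (Or.inl hx.symm)
  right; right
  intro u hu hlt
  rw [lastTime_append_singleton] at hlt ⊢
  have hu : u ≤ lastTime w := by
    rcases (stamps_append_singleton w a u).1 hu with h | h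
    · exact hT.timed.stamps_le h
    · exact absurd h hlt.ne
  obtain ⟨y, hy⟩ := hT.last
  by_cases hyx : y = x
  · subst hyx
    refine ⟨y, -1, ?_⟩
    rw [upd_of_mem hxY]
    obtain ⟨z, hz⟩ := hx
    have z0 : (0 : ℝ) < z := by linarith
    have z0 : 0 < z := by exact_mod_cast z0
    have z1 : (1 : ℝ) ≤ z := by exact_mod_cast z0
    push_cast
    constructor <;> linarith
  · refine ⟨y, 0, ?_⟩
    rw [upd_of_notMem, hy]
    · push_cast; constructor <;> linarith
    · intro hyY
      exact hyx (hinj ((upd_of_mem hyY).trans (upd_of_mem hxY).symm))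

/-- Just before t there are infinitely many times with no translate of a clock between them and t,
all equivalent to t, and only finitely many are excluded. -/
theorem exists_generic_time {t : ℝ} (ht : lastTime w < t) (h : ∀ x, ¬ ZEq t (c x)) :
    ∃ t', lastTime w ≤ t' ∧ SameAtoms m (fun x => t - c x) (fun x => t' - c x) ∧
      t' - m ∉ stamps w := by
  classical
  obtain ⟨s, hs, hav⟩ := exists_lt_avoiding (Finset.univ.image c) (s := t) (by simpa using h)
  obtain ⟨t', ⟨h1, h2⟩, h3⟩ := (Set.Ioo_infinite (max_lt hs ht)).exists_notMem_finset
    ((stamps w).image (· + (m : ℝ)))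
  have h1' := max_lt_iff.1 h1
  have hav' : ∀ x, ∀ z : ℤ, t' ≤ c x + z → ¬ c x + z ≤ t := fun x z hz =>
    hav (c x) (by simp) z (by linarith)
  refine ⟨t', h1'.2.le, ⟨fun x y z _ => by simp, fun x z _ => ?_, fun x z _ => ?_⟩, ?_⟩
  · constructor <;> intro hz
    · linarith
    · linarith [not_le.1 (hav' x z (by linarith))]
  · constructor <;> intro hz
    · by_contra hc
      exact hav' x z (by linarith) (by linarith)
    · linarith
  · intro hc
    exact h3 (Finset.mem_image.2 ⟨_, hc, by ring⟩)

/-- Similarity does not see all timestamps, so the word can be rebuilt letter by letter. Each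
reading time is carried over, and is perturbed inside its region when it exceeds the last time and
is congruent to no clock. -/
theorem exists_similar_isSparse (hk : 1 ≤ k) (hm : 1 ≤ m) (hA : A.ConstBoundedBy m)
    (hS : A.SmallSupports k) (h : Track A w c) :
    ∃ w' c', Track A w' c' ∧ IsSparse m w' c' ∧ Similar A w c w' c' := by
  induction h with
  | nil =>
    refine ⟨[], _, Track.nil, Or.inl ?_, Similar.refl _ _⟩
    have : (1 : ℝ) ≤ m := by exact_mod_cast hm
    simp only [lastTime_nil, Timed.mem_stamps, List.not_mem_nil]
    rintro (h | ⟨_, h, -⟩)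
    · linarith
    · exact h
  | @snoc w c a hw ha ih =>
    obtain ⟨w', c', hw', hsp, hsim⟩ := ih
    have hT := hw.tracks hk hA hS
    have hT' := hw'.tracks hk hA hS
    obtain ⟨σ, t⟩ := a
    have ht := (isTimedWord_append_singleton.1 ha).2
    simp only at ht
    obtain ⟨π, hπ, hc, -⟩ := id hsim
    have hl := map_lastTime hT hT' hc
    have ht' : lastTime w' ≤ π t := by rw [← hl]; exact π.monotone ht
    have hs := hπ.sameAtoms m t c
    simp only [hc] at hs
    have key : ∀ t', lastTime w' ≤ t' → SameAtoms m (fun x => t - c x) (fun x => t' - c' x) →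
        IsSparse m (w' ++ [(σ, t')]) (upd c' (resetSet A w' c' (σ, t')) t') → _ :=
      fun t' h1 h2 h3 => (⟨w' ++ [(σ, t')], upd c' (resetSet A w' c' (σ, t')) t',
        hw'.snoc (isTimedWord_append_singleton.2 ⟨hT'.timed, h1⟩), h3,
        (hsim.congr hA hT hT' ht h1 h2).2⟩ : ∃ w'' c'', Track A w'' c'' ∧ IsSparse m w'' c'' ∧
          Similar A (w ++ [(σ, t)]) (upd c (resetSet A w c (σ, t)) t) w'' c'')
    rcases ht'.eq_or_lt with he | hlt
    · exact key _ ht' hs (hsp.snoc_of_eq (a := (σ, π t)) hT' he.symm _)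
    by_cases hz : ∃ x, ZEq (π t) (c' x)
    · obtain ⟨x, hx⟩ := hz
      exact key _ ht' hs (isSparse_snoc_of_zeq (a := (σ, π t)) hT' hlt hx)
    · push Not at hz
      obtain ⟨t', h1, h2, h3⟩ := exists_generic_time (m := m) hlt hz
      exact key t' h1 (hs.trans h2) (IsSparse.snoc_of_notMem (a := (σ, t')) hm h3)

/-! ### Alignment of reset points -/

/-- Clocks are aligned one at a time. One congruent to an earlier clock follows automatically;
otherwise its present image and its target lie in the same arc between translates of the targets
already reached. -/
theorem exists_align_of_sub_lt_iff
    (h : ∀ x y (z : ℤ), c x - c y < z ↔ c' x - c' y < z) :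
    ∃ π : ℝ ≃o ℝ, IsTimedAutomorphism π ∧ ∀ x, π (c x) = c' x := by
  classical
  suffices ∀ s : Finset (Fin k), ∃ π : ℝ ≃o ℝ, IsTimedAutomorphism π ∧ ∀ x ∈ s, π (c x) = c' x by
    obtain ⟨π, hπ, hx⟩ := this Finset.univ
    exact ⟨π, hπ, fun x => hx x (Finset.mem_univ x)⟩
  have hgt : ∀ x y (z : ℤ), c y + z < c x → c' y + z < c' x := by
    intro x y z hz
    have := (h y x (-z)).1 (by push_cast; linarith)
    push_cast at this
    linarith
  have hlt : ∀ x y (z : ℤ), c x < c y + z → c' x < c' y + z := by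
    intro x y z hz
    have := (h x y z).1 (by linarith)
    linarith
  intro s
  induction s using Finset.induction_on with
  | empty => exact ⟨OrderIso.refl ℝ, IsTimedAutomorphism.refl, by simp⟩
  | insert x s hx ih =>
    rcases s.eq_empty_or_nonempty with rfl | ⟨y₀, hy₀⟩
    · obtain ⟨π, hπ, hx⟩ := exists_translation (c x) (c' x)
      exact ⟨π, hπ, by simpa using hx⟩
    obtain ⟨π, hπ, hs⟩ := ih
    by_cases hz : ∃ y ∈ s, ZEq (c x) (c y)
    · obtain ⟨y, hy, z, hz⟩ := hz
      refine ⟨π, hπ, fun x' hx' => ?_⟩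
      rcases Finset.mem_insert.1 hx' with rfl | hx'
      · rw [hz, hπ.map_add_int, hs y hy]
        apply le_antisymm
        · by_contra hc
          have := (h x' y z).2 (by linarith)
          linarith
        · by_contra hc
          have := (h y x' (-z)).2 (by push_cast; linarith)
          push_cast at this
          linarith
      · exact hs x' hx'
    · push Not at hz
      obtain ⟨ρ, hρ, hρf, hρx⟩ := exists_move (P := s.image c') ⟨c' y₀, Finset.mem_image_of_mem _ hy₀⟩
        (a := π (c x)) (b := c' x) (by
          intro p hp z h1 h2
          obtain ⟨y, hy, rfl⟩ := Finset.mem_image.1 hp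
          have e : c' y + z = π (c y + z) := by rw [hπ.map_add_int, hs y hy]
          rcases lt_trichotomy (c x) (c y + z) with hl | he | hl
          · refine absurd h2 (not_le.2 (max_lt ?_ (hlt x y z hl)))
            rw [e]; exact π.strictMono hl
          · exact hz y hy ⟨z, he⟩
          · refine absurd h1 (not_le.2 (lt_min ?_ (hgt x y z hl)))
            rw [e]; exact π.strictMono hl)
      refine ⟨π.trans ρ, hπ.trans hρ, fun x' hx' => ?_⟩
      rcases Finset.mem_insert.1 hx' with rfl | hx'
      · exact hρx
      · rw [OrderIso.trans_apply, hs x' hx']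
        exact hρf _ (Finset.mem_image_of_mem _ hx')

end TimedAutomaton
end Timed

namespace Timed
namespace TimedAutomaton

variable {Alph Loc : Type*} {A : TimedAutomaton Alph (Fin 1) Loc} {m k : ℕ}
variable {w w' : List (Alph × ℝ)} {c c' : Fin k → ℝ}

/-! ### Positions relative to the clocks -/

/-- The position of `u` relative to a finite set of points. -/
noncomputable def position (Q : Finset ℝ) (u : ℝ) : ℕ :=
  (Q.filter (· < u)).card + (Q.filter (· ≤ u)).card

theorem filter_lt_subset_filter_le (Q : Finset ℝ) (u : ℝ) : Q.filter (· < u) ⊆ Q.filter (· ≤ u) :=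
  Finset.monotone_filter_right _ fun _ _ h => le_of_lt h

/-- The i-th point of `Q`, counted from 0, has position 2i + 1 and the gap before it has position
2i. Only points above all of `Q` have position `2 * Q.card`. -/
theorem position_lt {Q : Finset ℝ} {l u : ℝ} (hl : l ∈ Q) (hu : u ≤ l) :
    position Q u < 2 * Q.card := by
  have h1 : (Q.filter (· < u)).card < Q.card :=
    Finset.card_lt_card (Finset.filter_ssubset.2 ⟨l, hl, not_lt.2 hu⟩)
  have h2 : (Q.filter (· ≤ u)).card ≤ Q.card := Finset.card_filter_le _ _
  simp only [position]
  omega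

theorem eq_or_avoids_of_position_eq_of_le {Q : Finset ℝ} {u u' : ℝ} (huu : u ≤ u')
    (h : position Q u = position Q u') : u = u' ∨ ∀ q ∈ Q, u ≤ q → ¬ q ≤ u' := by
  have h1 : Q.filter (· < u) ⊆ Q.filter (· < u') :=
    Finset.monotone_filter_right _ fun _ _ h => lt_of_lt_of_le h huu
  have h2 : Q.filter (· ≤ u) ⊆ Q.filter (· ≤ u') :=
    Finset.monotone_filter_right _ fun _ _ h => le_trans h huu
  have c1 := Finset.card_le_card h1
  have c2 := Finset.card_le_card h2
  simp only [position] at h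
  have e1 := Finset.eq_of_subset_of_card_le h1 (by omega)
  have e2 := Finset.eq_of_subset_of_card_le h2 (by omega)
  by_contra hc
  push Not at hc
  obtain ⟨hne, q, hq, hq1, hq2⟩ := hc
  have m2 : q ∈ Q.filter (· ≤ u) := by rw [e2]; exact Finset.mem_filter.2 ⟨hq, hq2⟩
  have m1 : q ∉ Q.filter (· < u') := by
    rw [← e1]; intro hh; exact absurd (Finset.mem_filter.1 hh).2 (not_lt.2 hq1)
  have m2 := (Finset.mem_filter.1 m2).2
  have m1 : u' ≤ q := by
    by_contra hcc; exact m1 (Finset.mem_filter.2 ⟨hq, not_le.1 hcc⟩)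
  exact hne (le_antisymm huu (m1.trans m2))

theorem eq_or_avoids_of_position_eq {Q : Finset ℝ} {u u' : ℝ}
    (h : position Q u = position Q u') :
    u = u' ∨ ∀ q ∈ Q, min u u' ≤ q → ¬ q ≤ max u u' := by
  rcases le_total u u' with hle | hle
  · rw [min_eq_left hle, max_eq_right hle]
    exact eq_or_avoids_of_position_eq_of_le hle h
  · rw [min_eq_right hle, max_eq_left hle]
    exact (eq_or_avoids_of_position_eq_of_le hle h.symm).imp_left Eq.symm

theorem position_image (Q : Finset ℝ) (π : ℝ ≃o ℝ) (u : ℝ) :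
    position (Q.image π) (π u) = position Q u := by
  simp only [position, Finset.filter_image, OrderIso.lt_iff_lt, OrderIso.le_iff_le]
  rw [Finset.card_image_of_injective _ π.injective, Finset.card_image_of_injective _ π.injective]

/-- Position 1, and the gap below the largest point treated next, are the two candidates for
elimination from codes. -/
theorem eq_of_position_eq_one {Q : Finset ℝ} {b u : ℝ} (hb : b ∈ Q) (hmin : ∀ q ∈ Q, b ≤ q)
    (h : position Q u = 1) : u = b := by
  have h1 := Finset.card_le_card (filter_lt_subset_filter_le Q u)
  simp only [position] at h
  have e1 : (Q.filter (· < u)).card = 0 := by omega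
  have e2 : 0 < (Q.filter (· ≤ u)).card := by omega
  obtain ⟨q, hq⟩ := Finset.card_pos.1 e2
  rw [Finset.card_eq_zero, Finset.filter_eq_empty_iff] at e1
  have := (Finset.mem_filter.1 hq)
  exact le_antisymm (not_lt.1 (e1 hb)) ((hmin q this.1).trans this.2)

theorem lt_of_position_eq {Q : Finset ℝ} {l u : ℝ} (hl : l ∈ Q) (hmax : ∀ q ∈ Q, q ≤ l)
    (hu : u ≤ l) (h : position Q u + 2 = 2 * Q.card) : u < l ∧ ∀ q ∈ Q, q < l → q < u := by
  have hlt : u < l := by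
    refine lt_of_le_of_ne hu ?_
    rintro rfl
    have e1 : Q.filter (· ≤ u) = Q := Finset.filter_true_of_mem hmax
    have e2 : Q.filter (· < u) = Q.erase u := by
      ext q
      simp only [Finset.mem_filter, Finset.mem_erase]
      exact ⟨fun h => ⟨h.2.ne, h.1⟩, fun h => ⟨h.2, lt_of_le_of_ne (hmax q h.2) h.1⟩⟩
    have := Finset.card_pos.2 ⟨u, hl⟩
    simp only [position, e1, e2, Finset.card_erase_of_mem hl] at h
    omega
  refine ⟨hlt, ?_⟩
  have h2 : Q.filter (· ≤ u) ⊆ Q.erase l := fun q hq => by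
    rw [Finset.mem_filter] at hq
    exact Finset.mem_erase.2 ⟨fun e => by subst e; linarith [hq.2], hq.1⟩
  have h1 := (filter_lt_subset_filter_le Q u).trans h2
  have c1 := Finset.card_le_card h1
  have c2 := Finset.card_le_card h2
  have c3 := Finset.card_pos.2 ⟨l, hl⟩
  rw [Finset.card_erase_of_mem hl] at c1 c2
  simp only [position] at h
  have e1 := Finset.eq_of_subset_of_card_le h1 (by rw [Finset.card_erase_of_mem hl]; omega)
  intro q hq hql
  have : q ∈ Q.filter (· < u) := by rw [e1]; exact Finset.mem_erase.2 ⟨hql.ne, hq⟩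
  exact (Finset.mem_filter.1 this).2

/-- The integer translates of the points `c x` between `l - m` and `l`. -/
noncomputable def translates (m : ℕ) (c : Fin k → ℝ) (l : ℝ) : Finset ℝ :=
  ((Finset.univ ×ˢ Finset.Icc (-(m : ℤ)) m).image fun p : Fin k × ℤ => c p.1 + p.2).filter
    fun q => l - m ≤ q ∧ q ≤ l

theorem Tracks.mem_translates (hA : A.ConstBoundedBy m) (h : Tracks A w c) {q : ℝ} :
    q ∈ translates m c (lastTime w) ↔
      (∃ x, ∃ z : ℤ, q = c x + z) ∧ lastTime w - m ≤ q ∧ q ≤ lastTime w := by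
  simp only [translates, Finset.mem_filter, Finset.mem_image, Finset.mem_product, Finset.mem_univ,
    true_and, Finset.mem_Icc, Prod.exists]
  refine and_congr_left fun hq => ⟨?_, ?_⟩
  · rintro ⟨x, z, -, rfl⟩; exact ⟨x, z, rfl⟩
  · rintro ⟨x, z, rfl⟩
    refine ⟨x, z, ?_, rfl⟩
    have h1 := h.ge hA x
    have h2 := h.le x
    have z1 : (-(m : ℤ) : ℝ) ≤ z := by push_cast; linarith
    have z2 : (z : ℝ) ≤ (m : ℤ) := by push_cast; linarith
    exact ⟨by exact_mod_cast z1, by exact_mod_cast z2⟩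

theorem card_translates_le (m : ℕ) (c : Fin k → ℝ) (l : ℝ) :
    (translates m c l).card ≤ (Finset.univ.image c).card * m + 1 := by
  classical
  have hex : ∀ q ∈ translates m c l, ∃ x, ∃ z : ℤ, q = c x + z := by
    intro q hq
    obtain ⟨⟨x, z⟩, -, hz⟩ := Finset.mem_image.1 (Finset.mem_filter.1 hq).1
    exact ⟨x, z, hz.symm⟩
  by_cases hk : Nonempty (Fin k)
  swap
  · have : translates m c l = ∅ := by
      rw [Finset.eq_empty_iff_forall_notMem]
      intro q hq
      obtain ⟨x, -⟩ := hex q hq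
      exact hk ⟨x⟩
    simp [this]
  choose! f g hfg using hex
  -- A translate in (l − m, l] is determined by the reset point and by ⌊l − q⌋, which is less than
  -- m. The end l − m accounts for the summand 1.
  have hcard : ((translates m c l).erase (l - m)).card ≤
      ((Finset.univ.image c) ×ˢ Finset.range m).card := by
    refine Finset.card_le_card_of_injOn (fun q => (c (f q), ⌊l - q⌋.toNat)) ?_ ?_
    · intro q hq
      have hq := Finset.mem_erase.1 hq
      have h1 := (Finset.mem_filter.1 hq.2).2
      have h2 : l - m < q := lt_of_le_of_ne h1.1 (Ne.symm hq.1)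
      have h3 : 0 ≤ ⌊l - q⌋ := Int.floor_nonneg.2 (by linarith)
      have h4 : ⌊l - q⌋ < m := Int.floor_lt.2 (by push_cast; linarith)
      simp only [Finset.coe_product, Set.mem_prod, Finset.mem_coe, Finset.mem_range]
      exact ⟨by simp, by omega⟩
    · intro q hq q' hq' h
      have hq := (Finset.mem_erase.1 hq).2
      have hq' := (Finset.mem_erase.1 hq').2
      have h1 := (Finset.mem_filter.1 hq).2
      have h1' := (Finset.mem_filter.1 hq').2
      simp only [Prod.mk.injEq] at h
      have h3 : 0 ≤ ⌊l - q⌋ := Int.floor_nonneg.2 (by linarith)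
      have h3' : 0 ≤ ⌊l - q'⌋ := Int.floor_nonneg.2 (by linarith)
      have h4 : ⌊l - q⌋ = ⌊l - q'⌋ := by omega
      have e := hfg q hq
      have e' := hfg q' hq'
      have h5 := Int.abs_sub_lt_one_of_floor_eq_floor h4
      rw [show l - q - (l - q') = ((g q' - g q : ℤ) : ℝ) by push_cast; linarith [h.1],
        ← Int.cast_abs] at h5
      have h5 : |g q' - g q| < 1 := by exact_mod_cast h5
      have h6 : g q' = g q := by
        have := Int.abs_lt_one_iff.1 h5; omega
      rw [e, e', h.1, h6]
  have := Finset.pred_card_le_card_erase (s := translates m c l) (a := l - m)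
  rw [Finset.card_product, Finset.card_range] at hcard
  omega

theorem Tracks.last_mem_translates (hA : A.ConstBoundedBy m) (h : Tracks A w c) :
    lastTime w ∈ translates m c (lastTime w) := by
  obtain ⟨x, hx⟩ := h.last
  exact (h.mem_translates hA).2 ⟨⟨x, 0, by simp [hx]⟩, by simp, le_rfl⟩

theorem Tracks.first_mem_translates (hA : A.ConstBoundedBy m) (h : Tracks A w c) :
    lastTime w - m ∈ translates m c (lastTime w) := by
  obtain ⟨x, hx⟩ := h.last
  exact (h.mem_translates hA).2 ⟨⟨x, -m, by simp [hx, sub_eq_add_neg]⟩, le_rfl, by simp⟩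

theorem translates_image (hA : A.ConstBoundedBy m) (h : Tracks A w c) (h' : Tracks A w' c')
    {π : ℝ ≃o ℝ} (hπ : IsTimedAutomorphism π) (hc : ∀ x, π (c x) = c' x) :
    translates m c' (lastTime w') = (translates m c (lastTime w)).image π := by
  have hl := map_lastTime h h' hc
  have hlm : π (lastTime w - m) = lastTime w' - m := by
    have := hπ.map_add_int (lastTime w) (-m)
    push_cast at this
    rw [← sub_eq_add_neg, ← sub_eq_add_neg, hl] at this
    exact this
  ext q
  rw [h'.mem_translates hA, Finset.mem_image]
  constructor
  · rintro ⟨⟨x, z, rfl⟩, h1, h2⟩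
    rw [← hc, ← hπ.map_add_int, ← hl, π.le_iff_le] at h2
    rw [← hc, ← hπ.map_add_int, ← hlm, π.le_iff_le] at h1
    exact ⟨c x + z, (h.mem_translates hA).2 ⟨⟨x, z, rfl⟩, h1, h2⟩, by rw [hπ.map_add_int, hc]⟩
  · rintro ⟨q, hq, rfl⟩
    obtain ⟨⟨x, z, rfl⟩, h1, h2⟩ := (h.mem_translates hA).1 hq
    rw [← hlm, ← hl, π.le_iff_le, π.le_iff_le]
    exact ⟨⟨x, z, by rw [hπ.map_add_int, hc]⟩, h1, h2⟩

theorem isTimedWord_append_mapWord {v : List (Alph × ℝ)} (h : IsTimedWord (w ++ v))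
    (hw' : IsTimedWord w') {π : ℝ ≃o ℝ} (hl : π (lastTime w) = lastTime w') :
    IsTimedWord (w' ++ mapWord π v) := by
  refine isTimedWord_append.2 ⟨hw', fun b hb => ?_, pairwise_mapWord.2 (isTimedWord_append.1 h).2.2⟩
  obtain ⟨a, ha, rfl⟩ := List.mem_map.1 hb
  rw [← hl]
  exact π.monotone ((isTimedWord_append.1 h).2.1 a ha)

/-- The quotient depends only on the positions of the reachable configurations. -/
theorem mapWord_mem_leftQuotient_of_positions (hA : A.ConstBoundedBy m) (h : Tracks A w c)
    (h' : Tracks A w' c') {π : ℝ ≃o ℝ} (hπ : IsTimedAutomorphism π) (hc : ∀ x, π (c x) = c' x)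
    (hpos : ∀ p d, A.Reach w p d → ∃ d', A.Reach w' p d' ∧
      position (translates m c (lastTime w)) (d 0) =
        position (translates m c' (lastTime w')) (d' 0))
    {v : List (Alph × ℝ)} (hv : v ∈ leftQuotient w A.language) :
    mapWord π v ∈ leftQuotient w' A.language := by
  obtain ⟨h1, p, d, h2, h3⟩ := mem_leftQuotient_language.1 hv
  obtain ⟨d', h4, h5⟩ := hpos p d h2
  have hl := map_lastTime h h' hc
  have ht := isTimedWord_append_mapWord h1 h'.timed hl
  have h6 := h3.map hπ
  rw [← position_image _ π, ← translates_image hA h h' hπ hc] at h5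
  have hul : π (d 0) ≤ lastTime w' := by
    rw [← hl]; exact π.monotone (h.timed.stamps_le (h2.mem_stamps 0))
  have hul' := h'.timed.stamps_le (h4.mem_stamps 0)
  rcases eq_or_avoids_of_position_eq h5 with e | hav
  · have : (fun x => π (d x)) = d' := funext fun x => by rw [Subsingleton.elim x 0, e]
    rw [this] at h6
    exact mem_leftQuotient_language.2 ⟨ht, p, d', h4, h6⟩
  rcases lt_or_ge (max (π (d 0)) (d' 0)) (lastTime w' - m) with hlt | hge
  · have hlt := max_lt_iff.1 hlt
    have hle := (isTimedWord_append.1 ht).2.1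
    exact mem_leftQuotient_language.2 ⟨ht, p, d', h4, h6.of_far hA
      (fun a ha => by linarith [hle a ha, hlt.1]) (fun a ha => by linarith [hle a ha, hlt.2])⟩
  have hmin : lastTime w' - m < min (π (d 0)) (d' 0) := by
    by_contra hc
    exact hav _ (h'.first_mem_translates hA) (not_lt.1 hc) hge
  obtain ⟨x₀, hx₀⟩ := h'.last
  -- Both points lie in one gap between translates of the clocks, so one can be moved to the other
  -- with the clocks fixed. As the clocks support the quotient, `ρ` does not affect membership.
  obtain ⟨ρ, hρ, hρf, hρu⟩ := exists_move (P := Finset.univ.image c') ⟨c' x₀, by simp⟩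
    (a := π (d 0)) (b := d' 0) (by
      intro q hq z hz1 hz2
      obtain ⟨x, -, rfl⟩ := Finset.mem_image.1 hq
      refine hav (c' x + z) ((h'.mem_translates hA).2 ⟨⟨x, z, rfl⟩, ?_, ?_⟩) hz1 hz2
      · linarith
      · exact hz2.trans (max_le hul hul'))
  rw [h'.supports hA ρ hρ (fun s hs => hρf s (Finset.mem_coe.1 hs))]
  have h7 := h6.map hρ
  have : (fun x => ρ (π (d x))) = d' := funext fun x => by rw [Subsingleton.elim x 0, hρu]
  rw [this] at h7
  refine mem_leftQuotient_language.2 ⟨isTimedWord_append_mapWord ht h'.timed ?_, p, d', h4, h7⟩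
  rw [← hx₀]
  exact hρf _ (by simp)

theorem similar_of_positions (hA : A.ConstBoundedBy m) (h : Tracks A w c)
    (h' : Tracks A w' c') {π : ℝ ≃o ℝ} (hπ : IsTimedAutomorphism π) (hc : ∀ x, π (c x) = c' x)
    (hpos : ∀ p d, A.Reach w p d → ∃ d', A.Reach w' p d' ∧
      position (translates m c (lastTime w)) (d 0) =
        position (translates m c' (lastTime w')) (d' 0))
    (hpos' : ∀ p d', A.Reach w' p d' → ∃ d, A.Reach w p d ∧
      position (translates m c' (lastTime w')) (d' 0) =
        position (translates m c (lastTime w)) (d 0)) :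
    Similar A w c w' c' := by
  refine ⟨π, hπ, hc, fun v => ⟨mapWord_mem_leftQuotient_of_positions hA h h' hπ hc hpos,
    fun hv => ?_⟩⟩
  rw [← mapWord_symm_mapWord π v]
  exact mapWord_mem_leftQuotient_of_positions hA h' h hπ.symm
    (fun x => by rw [OrderIso.symm_apply_eq, hc]) hpos' hv

end TimedAutomaton
end Timed

namespace Timed

/-! ### Regions -/

theorem exists_characteristic_constraint {X : Type*} {m : ℕ} (v : X → ℝ)
    (l : List (Constraint X)) (hl : ∀ ψ ∈ l, ψ.ConstBoundedBy m) :
    ∃ φ : Constraint X, φ.ConstBoundedBy m ∧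
      ∀ v', φ.Sat v' ↔ ∀ ψ ∈ l, (ψ.Sat v ↔ ψ.Sat v') := by
  induction l with
  | nil => exact ⟨.tt, trivial, fun v' => by simp [Constraint.Sat]⟩
  | cons ψ l ih =>
    obtain ⟨φ, hφ, h⟩ := ih fun ψ hψ => hl ψ (List.mem_cons_of_mem _ hψ)
    have hψ := hl ψ (List.mem_cons_self ..)
    by_cases hv : ψ.Sat v
    · exact ⟨.and ψ φ, ⟨hψ, hφ⟩, fun v' => by simp [Constraint.Sat, h, hv]⟩
    · exact ⟨.and (.not ψ) φ, ⟨hψ, hφ⟩, fun v' => by simp [Constraint.Sat, h, hv]⟩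

theorem exists_constraint_sat_iff_sameAtoms {k : ℕ} (m : ℕ) (v : Fin k → ℝ) :
    ∃ φ : Constraint (Fin k), φ.ConstBoundedBy m ∧ ∀ v', φ.Sat v' ↔ SameAtoms m v v' := by
  let l : List (Constraint (Fin k)) :=
    ((Finset.univ ×ˢ Finset.univ ×ˢ Finset.Icc (-(m : ℤ)) m).toList.map
      fun p : Fin k × Fin k × ℤ => .diff p.1 p.2.1 .lt p.2.2) ++
    ((Finset.univ ×ˢ Finset.Icc (-(m : ℤ)) m).toList.map
      fun p : Fin k × ℤ => .clock p.1 .lt p.2) ++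
    ((Finset.univ ×ˢ Finset.Icc (-(m : ℤ)) m).toList.map
      fun p : Fin k × ℤ => .clock p.1 .gt p.2)
  have hl : ∀ P : Constraint (Fin k) → Prop, (∀ ψ ∈ l, P ψ) ↔
      (∀ x y (z : ℤ), |z| ≤ m → P (.diff x y .lt z)) ∧
      (∀ x (z : ℤ), |z| ≤ m → P (.clock x .lt z)) ∧ (∀ x (z : ℤ), |z| ≤ m → P (.clock x .gt z)) := by
    intro P
    simp only [l, List.forall_mem_append, List.forall_mem_map, Finset.mem_toList,
      Finset.mem_product, Finset.mem_univ, true_and, Finset.mem_Icc, Prod.forall, abs_le, and_assoc]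
  obtain ⟨φ, hφ, h⟩ := exists_characteristic_constraint (m := m) v l
    ((hl _).2 ⟨fun _ _ _ h => h, fun _ _ h => h, fun _ _ h => h⟩)
  refine ⟨φ, hφ, fun v' => ?_⟩
  rw [h, hl]
  exact ⟨fun ⟨h1, h2, h3⟩ => ⟨h1, h2, h3⟩, fun ⟨h1, h2, h3⟩ => ⟨h1, h2, h3⟩⟩

/-- The characteristic constraint of `v` defines a region: a bounded constraint holds at all of its
solutions or at none. -/
theorem exists_isRegion_mem {k : ℕ} (m : ℕ) {v : Fin k → ℝ} (hv : ∀ x, 0 ≤ v x) :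
    ∃ R, IsRegion k m R ∧ v ∈ R := by
  obtain ⟨φ, hφ, h⟩ := exists_constraint_sat_iff_sameAtoms m v
  have hmem : v ∈ φ.sem :=
    ⟨hv, (h v).2 ⟨fun _ _ _ _ => Iff.rfl, fun _ _ _ => Iff.rfl, fun _ _ _ => Iff.rfl⟩⟩
  refine ⟨φ.sem, ⟨⟨φ, hφ, rfl⟩, ⟨v, hmem⟩, fun ψ hψ ⟨u, hu⟩ hss => hss.2 fun u' hu' => ⟨hu'.1, ?_⟩⟩,
    hmem⟩
  have h1 := (h u).1 (hss.1 hu).2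
  have h2 := (h u').1 hu'.2
  exact ((h1.symm.trans h2).sat_iff hψ).1 hu.2

theorem IsRegion.sat_of_sat {k m : ℕ} {R : Set (Fin k → ℝ)} (hR : IsRegion k m R)
    {v v' : Fin k → ℝ} (hv : v ∈ R) (hv' : v' ∈ R) {ψ : Constraint (Fin k)}
    (hψ : ψ.ConstBoundedBy m) (h : ψ.Sat v) : ψ.Sat v' := by
  obtain ⟨⟨φ, hφ, rfl⟩, -, hmin⟩ := hR
  by_contra hn
  refine hmin (.and φ ψ) ⟨hφ, hψ⟩ ⟨v, hv.1, hv.2, h⟩ ⟨fun u hu => ⟨hu.1, hu.2.1⟩, fun hss => ?_⟩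
  exact hn (hss hv').2.2

theorem IsRegion.sameAtoms {k m : ℕ} {R : Set (Fin k → ℝ)} (hR : IsRegion k m R)
    {v v' : Fin k → ℝ} (hv : v ∈ R) (hv' : v' ∈ R) : SameAtoms m v v' where
  diff x y z hz := ⟨hR.sat_of_sat hv hv' (ψ := .diff x y .lt z) hz,
    hR.sat_of_sat hv' hv (ψ := .diff x y .lt z) hz⟩
  lt x z hz := ⟨hR.sat_of_sat hv hv' (ψ := .clock x .lt z) hz,
    hR.sat_of_sat hv' hv (ψ := .clock x .lt z) hz⟩
  gt x z hz := ⟨hR.sat_of_sat hv hv' (ψ := .clock x .gt z) hz,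
    hR.sat_of_sat hv' hv (ψ := .clock x .gt z) hz⟩

/-- The type of regions. -/
abbrev Region (k m : ℕ) := {R : Set (Fin k → ℝ) // IsRegion k m R}

instance (k m : ℕ) : Finite (Region k m) := (finite_regions k m).to_subtype

theorem card_region (k m : ℕ) : Nat.card (Region k m) = regCount k m :=
  Nat.card_coe_set_eq _

theorem exists_region_map (k m : ℕ) :
    ∃ reg : (Fin k → ℝ) → Region k m, ∀ v, (∀ x, 0 ≤ v x) → v ∈ (reg v).1 := by
  have : ∀ v : Fin k → ℝ, ∃ R : Region k m, (∀ x, 0 ≤ v x) → v ∈ R.1 := by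
    intro v
    by_cases hv : ∀ x, 0 ≤ v x
    · obtain ⟨R, hR, hvR⟩ := exists_isRegion_mem m hv
      exact ⟨⟨R, hR⟩, fun _ => hvR⟩
    · obtain ⟨R, hR, -⟩ := exists_isRegion_mem m (v := fun _ : Fin k => 0) fun _ => le_rfl
      exact ⟨⟨R, hR⟩, fun h => absurd h hv⟩
  choose reg hreg using this
  exact ⟨reg, hreg⟩

namespace TimedAutomaton

variable {Alph Loc : Type*} {A : TimedAutomaton Alph (Fin 1) Loc} {m k : ℕ}
variable {w w' : List (Alph × ℝ)} {c c' : Fin k → ℝ}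

/-! ### Codes of states -/

/-- The number of positions kept in codes. -/
def width (k m : ℕ) : ℕ := if m = 0 then 2 else 2 * k * m + 1

/-- There is one position too many, and the position of points exactly `m` old is occupied. -/
def Crowded (m : ℕ) (w : List (Alph × ℝ)) (c : Fin k → ℝ) : Prop :=
  ¬ 2 * (translates m c (lastTime w)).card ≤ width k m ∧ lastTime w - m ∈ stamps w

open Classical in
/-- The position, with an unoccupied position eliminated where there is one position too many. -/
noncomputable def reducedPosition (m : ℕ) (w : List (Alph × ℝ)) (c : Fin k → ℝ) (u : ℝ) : ℕ :=
  if 2 * (translates m c (lastTime w)).card ≤ width k m then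
    position (translates m c (lastTime w)) u
  else if Crowded m w c then min (position (translates m c (lastTime w)) u) (width k m - 1)
  else position (translates m c (lastTime w)) u - 1

/-- The excess is at most one position. Two equal clocks would remove m ≥ 1 translates from the
bound, and for m = 0 there is only one translate. -/
theorem width_of_crowding (h : ¬ 2 * (translates m c (lastTime w)).card ≤ width k m) :
    1 ≤ m ∧ 2 * (translates m c (lastTime w)).card = width k m + 1 ∧ Function.Injective c := by
  have h1 := card_translates_le m c (lastTime w)
  have h2 : (Finset.univ.image c).card ≤ k := Finset.card_image_le.trans (by simp)
  have hm : 1 ≤ m := by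
    by_contra hm
    obtain rfl : m = 0 := by omega
    simp [width] at h h1
    omega
  have hw : width k m = 2 * (k * m) + 1 := by
    rw [width, if_neg (by omega), mul_assoc]
  have h3 : (Finset.univ.image c).card * m ≤ k * m := Nat.mul_le_mul_right m h2
  refine ⟨hm, by omega, ?_⟩
  by_contra hinj
  have h4 : (Finset.univ.image c).card < k := by
    refine lt_of_le_of_ne h2 fun e => hinj ?_
    have : Set.InjOn c (Finset.univ : Finset (Fin k)) :=
      Finset.card_image_iff.1 (by rw [e]; simp)
    simpa [Set.injOn_univ] using this
  have h5 : ((Finset.univ.image c).card + 1) * m ≤ k * m := Nat.mul_le_mul_right m h4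
  rw [add_mul, one_mul] at h5
  omega

theorem Tracks.position_lt (hA : A.ConstBoundedBy m) (h : Tracks A w c) {u : ℝ}
    (hu : u ∈ stamps w) :
    position (translates m c (lastTime w)) u < 2 * (translates m c (lastTime w)).card :=
  TimedAutomaton.position_lt (h.last_mem_translates hA) (h.timed.stamps_le hu)

theorem Tracks.reducedPosition_lt (hA : A.ConstBoundedBy m) (h : Tracks A w c) {u : ℝ}
    (hu : u ∈ stamps w) : reducedPosition m w c u < width k m := by
  have h1 := h.position_lt hA hu
  have h0 : 0 < width k m := by unfold width; split <;> omega
  unfold reducedPosition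
  split_ifs with h2 h3
  · omega
  · omega
  · have := (width_of_crowding h2).2.1
    omega

/-- In crowded states sparseness empties the gap before the last timestamp, position `width k m -
1`, so truncation merely lowers the top position into it. In overfull states that are not crowded,
position 1 is empty; lowering by one is then injective, with 0 kept by truncated subtraction. -/
theorem Tracks.position_eq_of_reducedPosition_eq (hA : A.ConstBoundedBy m) (h : Tracks A w c)
    (h' : Tracks A w' c') (hs : 1 ≤ m → IsSparse m w c) (hs' : 1 ≤ m → IsSparse m w' c')
    (hcr : Crowded m w c ↔ Crowded m w' c')
    (hcard : (translates m c (lastTime w)).card = (translates m c' (lastTime w')).card)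
    {u u' : ℝ} (hu : u ∈ stamps w) (hu' : u' ∈ stamps w')
    (he : reducedPosition m w c u = reducedPosition m w' c' u') :
    position (translates m c (lastTime w)) u = position (translates m c' (lastTime w')) u' := by
  by_cases hw : 2 * (translates m c (lastTime w)).card ≤ width k m
  · have hw' := hw
    rw [hcard] at hw'
    rwa [reducedPosition, reducedPosition, if_pos hw, if_pos hw'] at he
  have hw' := hw
  rw [hcard] at hw'
  have hlt := h.position_lt hA hu
  have hlt' := h'.position_lt hA hu'
  rw [reducedPosition, reducedPosition, if_neg hw, if_neg hw'] at he
  by_cases hc : Crowded m w c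
  · rw [if_pos hc, if_pos (hcr.1 hc)] at he
    have key : ∀ {w : List (Alph × ℝ)} {c : Fin k → ℝ}, Tracks A w c → (1 ≤ m → IsSparse m w c) →
        Crowded m w c → ∀ u ∈ stamps w,
          position (translates m c (lastTime w)) u ≠ width k m - 1 := by
      intro w c h hs hc u hu hpos
      obtain ⟨hm, hcard, hinj⟩ := width_of_crowding hc.1
      have hm' : (1 : ℝ) ≤ m := by exact_mod_cast hm
      have h0 : 0 < width k m := by unfold width; split <;> omega
      obtain ⟨h1, h2⟩ := lt_of_position_eq (h.last_mem_translates hA)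
        (fun q hq => ((h.mem_translates hA).1 hq).2.2) (h.timed.stamps_le hu)
        (by rw [hpos]; omega)
      rcases hs hm with h3 | h3 | h3
      · exact h3 hc.2
      · exact h3 hinj
      · obtain ⟨x, z, h4, h5⟩ := h3 u hu h1
        have h6 := h2 _ (h.first_mem_translates hA) (by linarith)
        have h7 := h2 (c x + z) ((h.mem_translates hA).2 ⟨⟨x, z, rfl⟩, by linarith, h5.le⟩) h5
        linarith
    have k1 := key h hs hc u hu
    have k2 := key h' hs' (hcr.1 hc) u' hu'
    have e1 := (width_of_crowding hw).2.1
    have e2 := (width_of_crowding hw').2.1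
    omega
  · rw [if_neg hc, if_neg (fun h => hc (hcr.2 h))] at he
    have key : ∀ {w : List (Alph × ℝ)} {c : Fin k → ℝ}, Tracks A w c →
        ¬ 2 * (translates m c (lastTime w)).card ≤ width k m → ¬ Crowded m w c → ∀ u ∈ stamps w,
          position (translates m c (lastTime w)) u ≠ 1 := by
      intro w c h hw hc u hu hpos
      have := eq_of_position_eq_one (h.first_mem_translates hA)
        (fun q hq => ((h.mem_translates hA).1 hq).2.1) hpos
      exact hc ⟨hw, this ▸ hu⟩
    have k1 := key h hw hc u hu
    have k2 := key h' hw' (fun h => hc (hcr.2 h)) u' hu'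
    omega

open Classical in
/-- The clock values, shifted by one in crowded states. -/
noncomputable def codeValuation (m : ℕ) (w : List (Alph × ℝ)) (c : Fin k → ℝ) : Fin k → ℝ :=
  fun x => lastTime w - c x + if Crowded m w c then 1 else 0

/-- The reduced positions of the reachable configurations. -/
def codePositions (A : TimedAutomaton Alph (Fin 1) Loc) (m : ℕ) (w : List (Alph × ℝ))
    (c : Fin k → ℝ) : Set (Loc × Fin (width k m)) :=
  {p | ∃ d, A.Reach w p.1 d ∧ reducedPosition m w c (d 0) = p.2}

theorem Tracks.codeValuation_nonneg (h : Tracks A w c) (x : Fin k) : 0 ≤ codeValuation m w c x := by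
  have := h.le x
  unfold codeValuation
  split_ifs <;> linarith

/-- Shifted values are all at least 1, whereas without the shift the clock reset last has value 0;
the constant 0 tells these apart. -/
theorem crowded_of_sameAtoms (h : Tracks A w c) (h' : Tracks A w' c')
    (hs : SameAtoms m (codeValuation m w c) (codeValuation m w' c')) (hc : Crowded m w c) :
    Crowded m w' c' := by
  by_contra hc'
  obtain ⟨x, hx⟩ := h'.last
  have h1 := hs.gt x 0 (by simp)
  have h2 := h.le x
  simp only [codeValuation, if_pos hc, if_neg hc', hx] at h1
  have := h1.1 (by push_cast; linarith)
  simp at this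

theorem similar_of_code_eq (hA : A.ConstBoundedBy m) (h : Tracks A w c) (h' : Tracks A w' c')
    (hs : 1 ≤ m → IsSparse m w c) (hs' : 1 ≤ m → IsSparse m w' c')
    (hv : SameAtoms m (codeValuation m w c) (codeValuation m w' c'))
    (hp : codePositions A m w c = codePositions A m w' c') : Similar A w c w' c' := by
  have hcr : Crowded m w c ↔ Crowded m w' c' :=
    ⟨crowded_of_sameAtoms h h' hv, crowded_of_sameAtoms h' h hv.symm⟩
  obtain ⟨π, hπ, hc⟩ := exists_align_of_sub_lt_iff (c := c) (c' := c') (by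
    intro x y z
    -- Reset points differ by at most m, so comparisons with larger constants have the same outcome
    -- on both sides.
    by_cases hz : |z| ≤ (m : ℤ)
    · have := hv.diff y x z hz
      simpa only [codeValuation, add_sub_add_right_eq_sub, sub_sub_sub_cancel_left] using this
    · have e1 := h.ge hA x
      have e2 := h.ge hA y
      have e3 := h.le x
      have e4 := h.le y
      have f1 := h'.ge hA x
      have f2 := h'.ge hA y
      have f3 := h'.le x
      have f4 := h'.le y
      rcases lt_abs.1 (not_le.1 hz) with hz | hz
      · have hz : (m : ℝ) < z := by exact_mod_cast hz
        exact iff_of_true (by linarith) (by linarith)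
      · have hz : (m : ℝ) < -z := by exact_mod_cast hz
        exact iff_of_false (by linarith) (by linarith))
  have hcard : (translates m c (lastTime w)).card = (translates m c' (lastTime w')).card := by
    rw [translates_image hA h h' hπ hc, Finset.card_image_of_injective _ π.injective]
  refine similar_of_positions hA h h' hπ hc (fun p d hd => ?_) (fun p d hd => ?_)
  · have : (p, ⟨reducedPosition m w c (d 0), h.reducedPosition_lt hA (hd.mem_stamps 0)⟩) ∈
        codePositions A m w c := ⟨d, hd, rfl⟩
    rw [hp] at this
    obtain ⟨d', hd', he⟩ := this
    exact ⟨d', hd', h.position_eq_of_reducedPosition_eq hA h' hs hs' hcr hcard (hd.mem_stamps 0)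
      (hd'.mem_stamps 0) he.symm⟩
  · have : (p, ⟨reducedPosition m w' c' (d 0), h'.reducedPosition_lt hA (hd.mem_stamps 0)⟩) ∈
        codePositions A m w' c' := ⟨d, hd, rfl⟩
    rw [← hp] at this
    obtain ⟨d', hd', he⟩ := this
    exact ⟨d', hd', h'.position_eq_of_reducedPosition_eq hA h hs' hs hcr.symm hcard.symm
      (hd.mem_stamps 0) (hd'.mem_stamps 0) he.symm⟩

/-- The number of locations of the determinised automaton. -/
noncomputable def locationBound (k m n : ℕ) : ℕ := regCount k m * 2 ^ (n * width k m)

theorem exists_classification [Fintype Loc] (hk : 1 ≤ k) (hA : A.ConstBoundedBy m)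
    (hS : A.SmallSupports k) :
    ∃ cls : List (Alph × ℝ) → (Fin k → ℝ) → Fin (locationBound k m (Fintype.card Loc)),
      ∀ w c w' c', Track A w c → Track A w' c' →
        (cls w c = cls w' c' ↔ Similar A w c w' c') := by
  classical
  obtain ⟨reg, hreg⟩ := exists_region_map k m
  let State := {s : List (Alph × ℝ) × (Fin k → ℝ) // Track A s.1 s.2}
  let st : Setoid State := ⟨fun s s' => Similar A s.1.1 s.1.2 s'.1.1 s'.1.2,
    fun s => Similar.refl _ _, fun h => h.symm, fun h h' => h.trans h'⟩
  have hgood : ∀ s : State, ∃ s' : State,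
      (1 ≤ m → IsSparse m s'.1.1 s'.1.2) ∧ Similar A s.1.1 s.1.2 s'.1.1 s'.1.2 := by
    intro s
    by_cases hm : 1 ≤ m
    · obtain ⟨w', c', h1, h2, h3⟩ := exists_similar_isSparse hk hm hA hS s.2
      exact ⟨⟨(w', c'), h1⟩, fun _ => h2, h3⟩
    · exact ⟨s, fun h => absurd h hm, Similar.refl _ _⟩
  choose good hsparse hsim using hgood
  let code : State → Region k m × Set (Loc × Fin (width k m)) := fun s =>
    (reg (codeValuation m s.1.1 s.1.2), codePositions A m s.1.1 s.1.2)
  have hcard : Nat.card (Region k m × Set (Loc × Fin (width k m))) =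
      locationBound k m (Fintype.card Loc) := by
    rw [Nat.card_prod, card_region, locationBound]
    simp [Nat.card_eq_fintype_card]
  let e := Finite.equivFinOfCardEq hcard
  -- Similar states may have different codes, so each class is encoded through one chosen
  -- representative, sparse if m ≥ 1.
  let canon : State → State := fun s => good (Quotient.mk st s).out
  have hcanon : ∀ s : State, Similar A s.1.1 s.1.2 (canon s).1.1 (canon s).1.2 := fun s =>
    Similar.trans (Similar.symm (Quotient.exact (Quotient.out_eq (Quotient.mk st s)))) (hsim _)
  have key : ∀ s s' : State, e (code (canon s)) = e (code (canon s')) ↔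
      Similar A s.1.1 s.1.2 s'.1.1 s'.1.2 := by
    intro s s'
    constructor
    · intro h
      have h := e.injective h
      simp only [code, Prod.mk.injEq] at h
      have hT := (canon s).2.tracks hk hA hS
      have hT' := (canon s').2.tracks hk hA hS
      refine (hcanon s).trans (Similar.trans ?_ (hcanon s').symm)
      refine similar_of_code_eq hA hT hT' (hsparse _) (hsparse _) ?_ h.2
      refine (reg (codeValuation m (canon s).1.1 (canon s).1.2)).2.sameAtoms
        (hreg _ fun x => hT.codeValuation_nonneg x) ?_
      rw [h.1]
      exact hreg _ fun x => hT'.codeValuation_nonneg x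
    · intro h
      have : Quotient.mk st s = Quotient.mk st s' := Quotient.sound h
      simp only [canon, this]
  -- Pairs that are not tracked receive the code of an arbitrary state, here the initial one.
  refine ⟨fun w c => if h : Track A w c then e (code (canon ⟨(w, c), h⟩)) else
    e (code ⟨([], fun _ => 0), Track.nil⟩), fun w c w' c' h h' => ?_⟩
  simp only [dif_pos h, dif_pos h']
  exact key _ _

/-! ### The determinised automaton -/

theorem exists_deterministic [Finite Alph] [Fintype Loc] (hk : 1 ≤ k) (hA : A.ConstBoundedBy m)
    (hS : A.SmallSupports k) :
    ∃ B : TimedAutomaton Alph (Fin k) (Fin (locationBound k m (Fintype.card Loc))),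
      B.Deterministic ∧ B.AlwaysResetting ∧ B.ConstBoundedBy m ∧ A.language = B.language := by
  classical
  obtain ⟨cls, hcls⟩ := exists_classification hk hA hS
  obtain ⟨reg, hreg⟩ := exists_region_map k m
  choose guard hguard hsem using fun R : Region k m => R.2.1
  let mk : Fin (locationBound k m (Fintype.card Loc)) × Alph × Region k m × Set (Fin k) ×
      Fin (locationBound k m (Fintype.card Loc)) → Rule Alph (Fin k) _ :=
    fun p => ⟨p.1, p.2.1, guard p.2.2.1, p.2.2.2.1, p.2.2.2.2⟩
  let data : Set (Fin (locationBound k m (Fintype.card Loc)) × Alph × Region k m × Set (Fin k) ×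
      Fin (locationBound k m (Fintype.card Loc))) :=
    {p | ∃ w c σ t, Track A w c ∧ IsTimedWord (w ++ [(σ, t)]) ∧
      p = (cls w c, σ, reg (fun x => t - c x), resetSet A w c (σ, t),
        cls (w ++ [(σ, t)]) (upd c (resetSet A w c (σ, t)) t))}
  let B : TimedAutomaton Alph (Fin k) (Fin (locationBound k m (Fintype.card Loc))) :=
    { init := {cls [] fun _ => 0}
      final := {q | ∃ w c, Track A w c ∧ q = cls w c ∧ w ∈ A.language}
      rules := mk '' data
      rules_finite := (Set.toFinite data).image mk }
  have hnonneg : ∀ {w : List (Alph × ℝ)} {c : Fin k → ℝ} {σ : Alph} {t : ℝ}, Track A w c →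
      IsTimedWord (w ++ [(σ, t)]) → ∀ x, 0 ≤ t - c x := fun h ht x =>
    sub_nonneg.2 (((h.tracks hk hA hS).le x).trans (isTimedWord_append_singleton.1 ht).2)
  have hcongr : ∀ {w w' : List (Alph × ℝ)} {c c' : Fin k → ℝ} {σ : Alph} {t t' : ℝ},
      Track A w c → Track A w' c' → IsTimedWord (w ++ [(σ, t)]) → IsTimedWord (w' ++ [(σ, t')]) →
      cls w c = cls w' c' → ∀ R : Region k m, (fun x => t - c x) ∈ R.1 →
      (fun x => t' - c' x) ∈ R.1 → resetSet A w c (σ, t) = resetSet A w' c' (σ, t') ∧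
        cls (w ++ [(σ, t)]) (upd c (resetSet A w c (σ, t)) t) =
          cls (w' ++ [(σ, t')]) (upd c' (resetSet A w' c' (σ, t')) t') := by
    intro w w' c c' σ t t' h h' ht ht' he R hR hR'
    have := ((hcls _ _ _ _ h h').1 he).congr (σ := σ) hA (h.tracks hk hA hS) (h'.tracks hk hA hS)
      (isTimedWord_append_singleton.1 ht).2 (isTimedWord_append_singleton.1 ht').2
      (R.2.sameAtoms hR hR')
    exact ⟨this.1, (hcls _ _ _ _ (h.snoc ht) (h'.snoc ht')).2 this.2⟩
  -- Rules are read off from arbitrary representatives, but by congruence the runs over `w` follow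
  -- the tracking of `w` itself.
  have hreach : ∀ w q d, IsTimedWord w → (B.Reach w q d ↔ Track A w d ∧ q = cls w d) := by
    intro w
    induction w using List.reverseRecOn with
    | nil =>
      intro q d _
      rw [reach_nil]
      constructor
      · rintro ⟨rfl, rfl⟩; exact ⟨Track.nil, rfl⟩
      · rintro ⟨h, rfl⟩
        have hd : d = fun _ => 0 := by
          have := (h.tracks hk hA hS).mem_stamps
          funext x
          simpa [Timed.mem_stamps] using this x
        subst hd
        exact ⟨rfl, rfl⟩
    | append_singleton w a ih =>
      obtain ⟨σ, t⟩ := a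
      intro q d hw
      rw [reach_append_singleton]
      constructor
      · rintro ⟨_, ⟨p, ⟨w₁, c₁, σ₁, t₁, h1, h2, rfl⟩, rfl⟩, c, hc, hσ, hsat, rfl, rfl⟩
        obtain ⟨hc, he⟩ := (ih _ _ hw.append_left).1 hc
        simp only [mk] at he hσ hsat ⊢
        subst hσ
        have hmem : (fun x => t - c x) ∈ (reg fun x => t₁ - c₁ x).1 := by
          rw [← hsem]; exact ⟨hnonneg hc hw, hsat⟩
        have := hcongr h1 hc h2 hw he _ (hreg _ (hnonneg h1 h2)) hmem
        rw [this.2, this.1]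
        exact ⟨hc.snoc hw, rfl⟩
      · rintro ⟨h, rfl⟩
        generalize hw' : w ++ [(σ, t)] = w' at h
        cases h with
        | nil => simp at hw'
        | @snoc w₁ c a h h' =>
          obtain ⟨rfl, e⟩ := List.append_inj' hw' rfl
          obtain rfl : (σ, t) = a := by simpa using e
          refine ⟨_, ⟨_, ⟨w, c, σ, t, h, hw, rfl⟩, rfl⟩, c, (ih _ _ hw.append_left).2 ⟨h, rfl⟩,
            rfl, ?_, rfl, rfl⟩
          have := hreg _ (hnonneg h hw)
          rw [← hsem] at this
          exact this.2
  refine ⟨B, ⟨⟨_, rfl, fun _ h => h⟩, ?_⟩, ?_, ?_, ?_⟩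
  · rintro _ ⟨_, ⟨w, c, σ, t, h, ht, rfl⟩, rfl⟩ _ ⟨_, ⟨w', c', σ', t', h', ht', rfl⟩, rfl⟩
      hs hl ⟨v, hv, hv1, hv2⟩
    simp only [mk] at hs hl hv1 hv2 ⊢
    subst hl
    have e1 : v ∈ (reg fun x => t - c x).1 := by rw [← hsem]; exact ⟨hv, hv1⟩
    have e2 : v ∈ (reg fun x => t' - c' x).1 := by rw [← hsem]; exact ⟨hv, hv2⟩
    have f1 := hreg _ (hnonneg h ht)
    have f2 := hreg _ (hnonneg h' ht')
    -- A common valuation links the clock values of the two representatives, so the second also lies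
    -- in the region of the first.
    have hsame := ((reg _).2.sameAtoms f1 e1).trans ((reg _).2.sameAtoms e2 f2)
    refine hcongr h h' ht ht' hs (reg fun x => t - c x) f1 ?_
    have h3 : (guard (reg fun x => t - c x)).Sat fun x => t - c x := by
      rw [← hsem] at f1; exact f1.2
    rw [← hsem]
    exact ⟨hnonneg h' ht', (hsame.sat_iff (hguard _)).1 h3⟩
  · rintro _ ⟨_, ⟨w, c, σ, t, h, ht, rfl⟩, rfl⟩
    exact (h.tracks hk hA hS).resetSet_nonempty hS ht
  · rintro _ ⟨_, ⟨w, c, σ, t, h, ht, rfl⟩, rfl⟩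
    exact hguard _
  · have htrack : ∀ w : List (Alph × ℝ), IsTimedWord w → ∃ c : Fin k → ℝ, Track A w c := by
      intro w
      induction w using List.reverseRecOn with
      | nil => exact fun _ => ⟨_, Track.nil⟩
      | append_singleton w a ih =>
        intro hw
        obtain ⟨c, hc⟩ := ih hw.append_left
        exact ⟨_, hc.snoc hw⟩
    ext w
    constructor
    · intro hw
      have ht := (mem_language_iff.1 hw).1
      obtain ⟨c, hc⟩ := htrack w ht
      exact mem_language_iff.2 ⟨ht, _, c, (hreach w _ c ht).2 ⟨hc, rfl⟩, w, c, hc, rfl, hw⟩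
    · intro hw
      obtain ⟨ht, q, c, hr, w', c', h', he, hw'⟩ := mem_language_iff.1 hw
      obtain ⟨hc, rfl⟩ := (hreach w q c ht).1 hr
      exact (((hcls _ _ _ _ hc h').1 he).mem_language_iff ht (h'.tracks hk hA hS).timed).2 hw'

end TimedAutomaton
end Timed

/-! ### The equivalence of the three conditions -/

theorem mainTheorem7 {Alph Loc : Type*} [Finite Alph] [Fintype Loc] (k m : ℕ) (hk : 1 ≤ k)
    (A : Timed.TimedAutomaton Alph (Fin 1) Loc) (hA : A.ConstBoundedBy m) :
    List.TFAE [
      ∃ (N : ℕ) (B : Timed.TimedAutomaton Alph (Fin k) (Fin N)),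
        B.Deterministic ∧ B.AlwaysResetting ∧ A.language = B.language,
      ∀ w : List (Alph × ℝ), Timed.IsTimedWord w →
        ∃ S : Finset ℝ, (∀ s ∈ S, 0 ≤ s) ∧ S.card ≤ k ∧ Timed.lastTime w ∈ S ∧
          Timed.IsInvariantUnder (S : Set ℝ) (Timed.leftQuotient w A.language),
      ∃ (N : ℕ) (B : Timed.TimedAutomaton Alph (Fin k) (Fin N)),
        B.Deterministic ∧ B.AlwaysResetting ∧ B.ConstBoundedBy m ∧ A.language = B.language ∧
          N ≤ Timed.regCount k m *
            2 ^ (Fintype.card Loc * (if m = 0 then 2 else 2 * k * m + 1))] := by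
  tfae_have 1 → 2 := by
    rintro ⟨N, B, hB, hB', hL⟩ w hw
    obtain ⟨S, h1, h2, h3, h4⟩ := Timed.TimedAutomaton.exists_support_of_deterministic hk hB hB' hw
    rw [← hL] at h4
    exact ⟨S, h1, h2, h3, (Timed.isInvariantUnder_leftQuotient_iff hw h3).2 h4⟩
  tfae_have 2 → 3 := by
    intro h
    obtain ⟨B, h1, h2, h3, h4⟩ := Timed.TimedAutomaton.exists_deterministic (k := k) hk hA
      (fun w hw => by
        obtain ⟨S, -, h2, h3, h4⟩ := h w hw
        exact ⟨S, h2, h3, (Timed.isInvariantUnder_leftQuotient_iff hw h3).1 h4⟩)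
    exact ⟨_, B, h1, h2, h3, h4, le_rfl⟩
  tfae_have 3 → 1 := by
    rintro ⟨N, B, h1, h2, -, h4, -⟩
    exact ⟨N, B, h1, h2, h4⟩
  tfae_finish
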